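/- Let $p$ be a prime. Write $(a;t)_n=\prod_{i=1}^{n}(1-at^{i-1})$ for $n\in\mathbb Z_{\ge 0}\cup\{\infty\}$, $\{y\}=y-\lfloor y\rfloor$ for the fractional part of a real $y$, and $\operatorname{corank}(M)=N-\operatorname{rank}(M)$ for an $N\times N$ matrix $M$. For two probability measures $M_1,M_2$ on $\mathbb Z$ let $D_\infty(M_1,M_2)=\sup_{x\in\mathbb Z}|M_1(\{x\})-M_2(\{x\})|$, and let $D_\infty(X_1,X_2)$ denote this distance between the laws of two $\mathbb Z$-valued random variables $X_1,X_2$. For every $t\in(0,1)$ and $\chi>0$, the formula $$\Pr\bigl(\mathcal L^{(1)}_{t,\chi}=x\bigr)=\frac{1}{(t;t)_\infty}\sum_{m\ge 0}e^{-\chi t^{x-m}}\,\frac{(-1)^m t^{\binom m2}}{(t;t)_m},\qquad x\in\mathbb Z,$$ (the series converges absolutely for every $x$) defines the law of a $\mathbb Z$-valued random variable $\mathcal L^{(1)}_{t,\chi}$: the right-hand sides are nonnegative and sum to $1$ over $x\in\mathbb Z$. For each $N\ge 1$ let $A^{(N)}_1,A^{(N)}_2,\dots$ be independent, uniformly distributed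 random elements of $\mathrm{Mat}_N(\mathbb F_p)$. Let $(s_N)_{N\ge1}$ be any sequence of natural numbers such that $s_N\to\infty$ and $N-\log_p s_N\to\infty$ as $N\to\infty$. Then the $\mathbb Z$-valued random variables $$X^{(1)}_N=\operatorname{corank}\bigl(A^{(N)}_{s_N}\cdots A^{(N)}_2A^{(N)}_1\bigr)-\lfloor\log_p s_N\rfloor$$ satisfy $$\lim_{N\to\infty}D_\infty\Bigl(X^{(1)}_N,\ \mathcal L^{(1)}_{p^{-1},\,p^{\{\log_p s_N\}}/(p-1)}\Bigr)=0.$$ -/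

import Mathlib

open MeasureTheory ProbabilityTheory Filter Topology

/-- The discrete `σ`-algebra on `Mat_N(𝔽_p)`. -/
instance matModMeasurableSpace (p N : ℕ) :
    MeasurableSpace (Matrix (Fin N) (Fin N) (ZMod p)) := ⊤

/-- The finite `q`-Pochhammer symbol `(a;t)_n = ∏_{i=1}^n (1 - a t^{i-1})`. -/
noncomputable def qPoch (a t : ℝ) (n : ℕ) : ℝ :=
  ∏ i ∈ Finset.range n, (1 - a * t ^ i)

/-- The infinite `q`-Pochhammer symbol `(a;t)_∞ = ∏_{i ≥ 1} (1 - a t^{i-1})`; the product converges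
for `0 < t < 1`, the only range in which it is used. -/
noncomputable def qPochInf (a t : ℝ) : ℝ :=
  ∏' i : ℕ, (1 - a * t ^ i)

/-- The `m`-th term `e^{-χ t^{x-m}} (-1)^m t^{m(m-1)/2} / (t;t)_m` of the series that defines the
limit law. -/
noncomputable def limitTerm (t χ : ℝ) (x : ℤ) (m : ℕ) : ℝ :=
  Real.exp (-χ * t ^ (x - (m : ℤ))) * ((-1) ^ m * t ^ (m.choose 2) / qPoch t t m)

/-- The real number `(1/(t;t)_∞) ∑_{m ≥ 0} e^{-χ t^{x-m}} (-1)^m t^{m(m-1)/2} / (t;t)_m`. -/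
noncomputable def limitProb (t χ : ℝ) (x : ℤ) : ℝ :=
  1 / qPochInf t t * ∑' m : ℕ, limitTerm t χ x m

/-- The law of the `ℤ`-valued random variable `ℒ^{(1)}_{t,χ}`: the measure on `ℤ` that puts mass
`limitProb t χ x` on each integer `x`. -/
noncomputable def limitLaw (t χ : ℝ) : Measure ℤ :=
  Measure.sum fun x : ℤ => ENNReal.ofReal (limitProb t χ x) • Measure.dirac x

/-- The distance `D_∞(M₁, M₂) = sup_x |M₁({x}) - M₂({x})|` between two probability measures on a
set with the discrete `σ`-algebra (the supremum is over a set bounded by `1`). -/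
noncomputable def Dinf {S : Type*} [MeasurableSpace S] (M₁ M₂ : Measure S) : ℝ :=
  ⨆ x : S, |M₁.real {x} - M₂.real {x}|

/-- The corank `N - rank M` of an `N × N` matrix over a field. -/
noncomputable def corank {K : Type*} [Field K] {N : ℕ} (M : Matrix (Fin N) (Fin N) K) : ℤ :=
  (N : ℤ) - (M.rank : ℤ)

/-- The product `A_{s-1} ⋯ A_1 A_0` of the first `s` terms of a sequence of matrices, each new
factor standing on the left; it is the identity for `s = 0`. -/
def leftProd {R : Type*} [Semiring R] {N : ℕ} (A : ℕ → Matrix (Fin N) (Fin N) R) :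
    ℕ → Matrix (Fin N) (Fin N) R
  | 0 => 1
  | s + 1 => A s * leftProd A s

/-- The shifted corank `corank(A_s ⋯ A_1) - ⌊log_p s⌋`, where `A i` stands for `A_{i+1}`. -/
noncomputable def shiftedCorank (p : ℕ) [Fact p.Prime] {N : ℕ} (s : ℕ)
    (A : ℕ → Matrix (Fin N) (Fin N) (ZMod p)) : ℤ :=
  corank (leftProd A s) - ⌊Real.logb p s⌋

/-! Put t = 1/p. A uniform d-tuple of vectors has independent images under a matrix of rank r with
probability `injProb t r d`, so these numbers act as moments of the rank. For a product of s uniform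
matrices they are explicit: each factor sends an independent tuple to a uniform one, so a fixed
independent tuple survives with probability `injProb t N d ^ s`, and choosing the tuple uniformly
adds one more factor (`sum_measureReal_leftProd_mul_injProb`). The system is triangular in r and
Euler's coefficients invert it (`sum_qCoef_mul_injProb`), which gives an exact finite formula for
the law of the rank (`measureReal_rank_leftProd_eq`).

At corank K the m-th term contains ((t;t)_N / (t;t)_{K-m})^{s+1}, which is close to exp(-s t^{K-m}
t/(1-t)) (`abs_div_pow_sub_exp_le`). For K = x + ⌊log_p s⌋ this exponential is e^{-χ t^{x-m}}. The
total error is controlled by 1/s and s t^N uniformly in x, and both tend to 0.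

The limit formula is a law by the same q-series: finite truncations are nonnegative by induction
(`sum_qCoef_mul_exp_nonneg`), and an explicit distribution function telescopes (`limitCdf_sub`). -/

/-- The coefficient `(-1)^m t^{m(m-1)/2} / (t;t)_m` of Euler's expansion of `(z;t)_∞`. -/
noncomputable def qCoef (t : ℝ) (m : ℕ) : ℝ :=
  (-1) ^ m * t ^ (m.choose 2) / qPoch t t m

lemma qPoch_zero (a t : ℝ) : qPoch a t 0 = 1 := by simp [qPoch]

lemma qPoch_succ (a t : ℝ) (n : ℕ) : qPoch a t (n + 1) = qPoch a t n * (1 - a * t ^ n) := by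
  simp [qPoch, Finset.prod_range_succ]

lemma qPoch_self_succ (t : ℝ) (n : ℕ) :
    qPoch t t (n + 1) = qPoch t t n * (1 - t ^ (n + 1)) := by
  rw [qPoch_succ, pow_succ']

/-! ### Euler's q-series: convergence, identities, positivity. -/

section QSeries

variable {t : ℝ} (h0 : 0 < t) (h1 : t < 1)
include h0 h1

lemma qPoch_self_pos (n : ℕ) : 0 < qPoch t t n := by
  induction n with
  | zero => simp [qPoch_zero]
  | succ n ih =>
    rw [qPoch_self_succ]
    have : t ^ (n + 1) < 1 := pow_lt_one₀ h0.le h1 (by omega)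
    exact mul_pos ih (by linarith)

lemma qPoch_self_ne (n : ℕ) : qPoch t t n ≠ 0 := (qPoch_self_pos h0 h1 n).ne'

lemma qPoch_self_antitone : Antitone (qPoch t t) := by
  refine antitone_nat_of_succ_le fun n => ?_
  rw [qPoch_self_succ]
  have : 0 < t ^ (n + 1) := pow_pos h0 _
  nlinarith [qPoch_self_pos h0 h1 n]

lemma qPoch_self_le_one (n : ℕ) : qPoch t t n ≤ 1 := by
  simpa [qPoch_zero] using qPoch_self_antitone h0 h1 (Nat.zero_le n)

lemma tendsto_qPoch_self : Tendsto (qPoch t t) atTop (𝓝 (qPochInf t t)) := by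
  have hs : Summable fun i : ℕ => -(t * t ^ i) :=
    ((summable_geometric_of_lt_one h0.le h1).mul_left t).neg
  have := (Real.multipliable_one_add_of_summable hs).tendsto_prod_tprod_nat
  simp only [← sub_eq_add_neg] at this
  exact this

lemma exp_neg_le_one_sub {u : ℝ} (hu0 : 0 ≤ u) (hu : u ≤ t) :
    Real.exp (-(u / (1 - t))) ≤ 1 - u := by
  have h2 : 0 < 1 - t := by linarith
  have h3 : 0 < 1 - u := by linarith
  rw [Real.exp_neg, inv_le_comm₀ (Real.exp_pos _) h3]
  have h4 : (1 - u)⁻¹ ≤ u / (1 - t) + 1 := by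
    rw [inv_le_iff_one_le_mul₀ h3, div_add_one h2.ne', div_mul_eq_mul_div, le_div_iff₀ h2]
    nlinarith
  exact h4.trans (Real.add_one_le_exp _)

/-- The exponents t^i/(1-t) supplied by `exp_neg_le_one_sub` form a geometric sum, bounded in n;
this keeps the infinite product away from 0. -/
lemma exp_le_qPoch_self (n : ℕ) :
    Real.exp (-(t * (1 - t ^ n) / (1 - t) ^ 2)) ≤ qPoch t t n := by
  induction n with
  | zero => simp [qPoch_zero]
  | succ n ih =>
    have h2 : 0 < 1 - t := by linarith
    have h3 : t ^ (n + 1) ≤ t := pow_le_of_le_one h0.le h1.le (by omega)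
    rw [qPoch_self_succ]
    refine le_trans (le_of_eq ?_) (mul_le_mul ih
      (exp_neg_le_one_sub h0 h1 (pow_pos h0 _).le h3) (Real.exp_pos _).le
      (qPoch_self_pos h0 h1 n).le)
    rw [← Real.exp_add]
    congr 1
    field_simp
    ring

lemma qPochInf_self_pos : 0 < qPochInf t t := by
  refine (Real.exp_pos (-(t / (1 - t) ^ 2))).trans_le
    (ge_of_tendsto' (tendsto_qPoch_self h0 h1) fun n => le_trans ?_ (exp_le_qPoch_self h0 h1 n))
  have : 0 < 1 - t := by linarith
  have h3 : 0 < t ^ n := pow_pos h0 n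
  gcongr
  nlinarith

lemma qPochInf_self_le (n : ℕ) : qPochInf t t ≤ qPoch t t n :=
  (qPoch_self_antitone h0 h1).le_of_tendsto (tendsto_qPoch_self h0 h1) n

lemma qPoch_self_sub_le (R n : ℕ) :
    qPoch t t R - qPoch t t (R + n) ≤ (t ^ R - t ^ (R + n)) / (1 - t) := by
  have h2 : 0 < 1 - t := by linarith
  induction n with
  | zero => simp
  | succ n ih =>
    rw [← add_assoc, qPoch_self_succ]
    have h3 : qPoch t t (R + n) * t ^ (R + n + 1) ≤ t ^ (R + n) := by
      have h4 : t ^ (R + n + 1) ≤ t ^ (R + n) := pow_le_pow_of_le_one h0.le h1.le (by omega)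
      have := qPoch_self_le_one h0 h1 (R + n)
      have h5 : 0 < t ^ (R + n + 1) := pow_pos h0 _
      nlinarith
    have h6 : (t ^ R - t ^ (R + n + 1)) / (1 - t)
        = (t ^ R - t ^ (R + n)) / (1 - t) + t ^ (R + n) := by
      field_simp
      ring
    rw [h6]
    linarith

lemma qPoch_self_sub_qPochInf_le (R : ℕ) :
    qPoch t t R - qPochInf t t ≤ t ^ R / (1 - t) := by
  have h2 : 0 < 1 - t := by linarith
  have h3 : Tendsto (fun n => qPoch t t R - qPoch t t (R + n)) atTop
      (𝓝 (qPoch t t R - qPochInf t t)) := by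
    refine tendsto_const_nhds.sub ?_
    simpa [add_comm] using (tendsto_add_atTop_iff_nat R).2 (tendsto_qPoch_self h0 h1)
  refine le_of_tendsto' h3 fun n => (qPoch_self_sub_le h0 h1 R n).trans ?_
  gcongr
  linarith [pow_pos h0 (R + n)]

/-- Coefficient form of f(z) - f(tz) = -z f(tz) for f(z) = (z;t)_∞. -/
lemma qCoef_succ (m : ℕ) :
    qCoef t (m + 1) * (1 - t ^ (m + 1)) = -(t ^ m * qCoef t m) := by
  have h3 := qPoch_self_ne h0 h1 m
  have h4 : t ^ (m + 1) < 1 := pow_lt_one₀ h0.le h1 (by omega)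
  have h5 : 1 - t ^ (m + 1) ≠ 0 := by linarith
  have h6 : (m + 1).choose 2 = m + m.choose 2 := by
    rw [Nat.choose_succ_succ' m 1, Nat.choose_one_right]
  rw [qCoef, qCoef, qPoch_self_succ, h6, pow_add t, pow_succ]
  field_simp

lemma qCoef_ne (m : ℕ) : qCoef t m ≠ 0 := by
  unfold qCoef
  have := qPoch_self_ne h0 h1 m
  positivity

lemma summable_abs_qCoef_mul_pow (z : ℝ) (hz : 0 < z) :
    Summable fun m : ℕ => |qCoef t m| * z ^ m := by
  refine summable_of_ratio_test_tendsto_lt_one (l := 0) one_pos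
    (Eventually.of_forall fun m => mul_ne_zero (abs_ne_zero.2 (qCoef_ne h0 h1 m))
      (pow_pos hz m).ne') ?_
  have h2 : Tendsto (fun m : ℕ => t ^ m) atTop (𝓝 0) := tendsto_pow_atTop_nhds_zero_of_lt_one h0.le h1
  have h3 : Tendsto (fun m : ℕ => z * t ^ m / (1 - t ^ (m + 1))) atTop (𝓝 (z * 0 / (1 - 0))) :=
    (h2.const_mul z).div (tendsto_const_nhds.sub ((tendsto_add_atTop_iff_nat 1).2 h2)) (by norm_num)
  rw [mul_zero, zero_div] at h3
  refine h3.congr fun m => ?_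
  have h4 : 0 < 1 - t ^ (m + 1) := by
    have : t ^ (m + 1) < 1 := pow_lt_one₀ h0.le h1 (by omega)
    linarith
  have h5 : qCoef t (m + 1) = -(t ^ m * qCoef t m) / (1 - t ^ (m + 1)) := by
    rw [← qCoef_succ h0 h1]
    field_simp
  have h6 : |qCoef t m| ≠ 0 := abs_ne_zero.2 (qCoef_ne h0 h1 m)
  rw [h5, Real.norm_of_nonneg (by positivity), Real.norm_of_nonneg (by positivity), abs_div,
    abs_neg, abs_mul, abs_of_pos h4, abs_of_pos (pow_pos h0 m), pow_succ z]
  field_simp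

lemma summable_abs_qCoef : Summable fun m : ℕ => |qCoef t m| := by
  simpa using summable_abs_qCoef_mul_pow h0 h1 1 one_pos

lemma summable_qCoef_mul {u : ℕ → ℝ} {C : ℝ} (hu : ∀ m, |u m| ≤ C) :
    Summable fun m => qCoef t m * u m := by
  refine Summable.of_norm_bounded ((summable_abs_qCoef h0 h1).mul_right C) fun m => ?_
  rw [Real.norm_eq_abs, abs_mul]
  exact mul_le_mul_of_nonneg_left (hu m) (abs_nonneg _)

lemma abs_tsum_qCoef_mul_le {u : ℕ → ℝ} {C : ℝ} (hu : ∀ m, |u m| ≤ C) :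
    |∑' m, qCoef t m * u m| ≤ (∑' m, |qCoef t m|) * C := by
  rw [← tsum_mul_right, ← Real.norm_eq_abs]
  refine tsum_of_norm_bounded ((summable_abs_qCoef h0 h1).mul_right C).hasSum fun m => ?_
  rw [Real.norm_eq_abs, abs_mul]
  exact mul_le_mul_of_nonneg_left (hu m) (abs_nonneg _)

/-- Dominated convergence, since 1/(t;t)_{n-m} ≤ 1/(t;t)_∞. It carries finite identities and
inequalities over to the limit series. -/
lemma tendsto_sum_qCoef_mul_div {u : ℕ → ℝ} {C : ℝ} (hu : ∀ m, |u m| ≤ C) :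
    Tendsto (fun n => ∑ m ∈ Finset.range (n + 1), qCoef t m * u m / qPoch t t (n - m)) atTop
      (𝓝 (1 / qPochInf t t * ∑' m, qCoef t m * u m)) := by
  have hP := qPochInf_self_pos h0 h1
  rw [← tsum_mul_left]
  have key : Tendsto (fun n => ∑' m, if m ∈ Finset.range (n + 1) then
      qCoef t m * u m / qPoch t t (n - m) else 0) atTop
      (𝓝 (∑' m, 1 / qPochInf t t * (qCoef t m * u m))) := by
    refine tendsto_tsum_of_dominated_convergence
      (bound := fun m => |qCoef t m| * (C / qPochInf t t))
      ((summable_abs_qCoef h0 h1).mul_right _) (fun m => ?_)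
      (Eventually.of_forall fun n m => ?_)
    · have h2 : Tendsto (fun n => qCoef t m * u m / qPoch t t (n - m)) atTop
          (𝓝 (1 / qPochInf t t * (qCoef t m * u m))) := by
        rw [one_div_mul_eq_div]
        exact tendsto_const_nhds.div
          ((tendsto_qPoch_self h0 h1).comp (tendsto_sub_atTop_nat m)) hP.ne'
      refine h2.congr' ?_
      filter_upwards [eventually_ge_atTop m] with n hn
      rw [if_pos (Finset.mem_range.2 (by omega))]
    · have hC : 0 ≤ C := (abs_nonneg _).trans (hu 0)
      split_ifs
      · rw [Real.norm_eq_abs, abs_div, abs_mul, abs_of_pos (qPoch_self_pos h0 h1 _), mul_div_assoc]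
        gcongr
        · exact hu m
        · exact qPochInf_self_le h0 h1 _
      · simp only [norm_zero]
        positivity
  refine key.congr fun n => ?_
  rw [tsum_eq_sum (s := Finset.range (n + 1)) (by intro m hm; simp only [if_neg hm])]
  exact Finset.sum_congr rfl fun m hm => if_pos hm

lemma one_sub_pow_div_qPoch_self (n : ℕ) :
    (1 - t ^ (n + 1)) / qPoch t t (n + 1) = 1 / qPoch t t n := by
  have h3 := qPoch_self_ne h0 h1 n
  have h4 : t ^ (n + 1) < 1 := pow_lt_one₀ h0.le h1 (by omega)
  have h5 : 1 - t ^ (n + 1) ≠ 0 := by linarith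
  rw [qPoch_self_succ]
  field_simp

/-- The coefficient of z^{n+1} in (z;t)_∞ · 1/(z;t)_∞ = 1. After multiplication by 1 - t^{n+1} = (1
- t^m) + t^m (1 - t^{n+1-m}), the two parts cancel by `qCoef_succ`. -/
lemma sum_qCoef_div_qPoch (n : ℕ) :
    ∑ m ∈ Finset.range (n + 2), qCoef t m / qPoch t t (n + 1 - m) = 0 := by
  have h4 : t ^ (n + 1) < 1 := pow_lt_one₀ h0.le h1 (by omega)
  have h5 : 1 - t ^ (n + 1) ≠ 0 := by linarith
  refine (mul_eq_zero.1 ?_).resolve_left h5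
  have hA : ∑ m ∈ Finset.range (n + 2), qCoef t m * (1 - t ^ m) / qPoch t t (n + 1 - m)
      = -∑ m ∈ Finset.range (n + 1), t ^ m * qCoef t m / qPoch t t (n - m) := by
    rw [Finset.sum_range_succ', ← Finset.sum_neg_distrib]
    simp only [pow_zero, sub_self, mul_zero, zero_div, add_zero]
    refine Finset.sum_congr rfl fun m _ => ?_
    rw [qCoef_succ h0 h1, Nat.add_sub_add_right, neg_div]
  have hB : ∑ m ∈ Finset.range (n + 2),
      t ^ m * qCoef t m * ((1 - t ^ (n + 1 - m)) / qPoch t t (n + 1 - m))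
      = ∑ m ∈ Finset.range (n + 1), t ^ m * qCoef t m / qPoch t t (n - m) := by
    rw [Finset.sum_range_succ]
    simp only [Nat.sub_self, pow_zero, sub_self, zero_div, mul_zero, add_zero]
    refine Finset.sum_congr rfl fun m hm => ?_
    have : n + 1 - m = (n - m) + 1 := by have := Finset.mem_range.1 hm; omega
    rw [this, one_sub_pow_div_qPoch_self h0 h1, mul_one_div]
  rw [← add_eq_zero_iff_eq_neg.2 hA, ← hB, ← Finset.sum_add_distrib, Finset.mul_sum]
  refine Finset.sum_congr rfl fun m hm => ?_
  have : t ^ (n + 1) = t ^ m * t ^ (n + 1 - m) := by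
    rw [← pow_add]; congr 1; have := Finset.mem_range.1 hm; omega
  rw [this]
  ring

/-- The coefficient of z^n in (tz;t)_∞ / (z;t)_∞ = 1/(1-z). Consecutive sums differ by t^{n+1} times
the vanishing sum of `sum_qCoef_div_qPoch`. -/
lemma sum_qCoef_mul_pow_div_qPoch (n : ℕ) :
    ∑ m ∈ Finset.range (n + 1), qCoef t m * t ^ m / qPoch t t (n - m) = 1 := by
  induction n with
  | zero => simp [qCoef, qPoch_zero]
  | succ n ih =>
    rw [← ih, ← sub_eq_zero]
    have hB : ∑ m ∈ Finset.range (n + 1), qCoef t m * t ^ m / qPoch t t (n - m)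
        = ∑ m ∈ Finset.range (n + 2),
          qCoef t m * t ^ m * ((1 - t ^ (n + 1 - m)) / qPoch t t (n + 1 - m)) := by
      symm
      rw [Finset.sum_range_succ]
      simp only [Nat.sub_self, pow_zero, sub_self, zero_div, mul_zero, add_zero]
      refine Finset.sum_congr rfl fun m hm => ?_
      have : n + 1 - m = (n - m) + 1 := by have := Finset.mem_range.1 hm; omega
      rw [this, one_sub_pow_div_qPoch_self h0 h1, mul_one_div]
    rw [hB, ← Finset.sum_sub_distrib, ← mul_zero (t ^ (n + 1)), ← sum_qCoef_div_qPoch h0 h1 n,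
      Finset.mul_sum]
    refine Finset.sum_congr rfl fun m hm => ?_
    have : t ^ (n + 1) = t ^ m * t ^ (n + 1 - m) := by
      rw [← pow_add]; congr 1; have := Finset.mem_range.1 hm; omega
    rw [this]
    ring

lemma tsum_qCoef : ∑' m, qCoef t m = 0 := by
  have h := tendsto_sum_qCoef_mul_div h0 h1 (u := fun _ => 1) (C := 1) (by simp)
  have h2 := (tendsto_add_atTop_iff_nat 1).2 h
  simp only [mul_one] at h2
  have h3 := tendsto_nhds_unique (h2.congr fun n => sum_qCoef_div_qPoch h0 h1 n) tendsto_const_nhds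
  exact (mul_eq_zero.1 h3).resolve_left (one_div_pos.2 (qPochInf_self_pos h0 h1)).ne'

lemma tsum_qCoef_mul_pow : 1 / qPochInf t t * ∑' m, qCoef t m * t ^ m = 1 := by
  have h := tendsto_sum_qCoef_mul_div h0 h1 (u := fun m => t ^ m) (C := 1) fun m => by
    rw [abs_of_pos (pow_pos h0 m)]
    exact pow_le_one₀ h0.le h1.le
  exact tendsto_nhds_unique (h.congr fun n => sum_qCoef_mul_pow_div_qPoch h0 h1 n)
    tendsto_const_nhds

/-- Multiplying the sum for n+1 by exp(y t^{-(n+1)}) makes its last term constant in y, and the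
derivative is then a positive multiple of the sum for n. At y = 0 the value is 0 by
`sum_qCoef_div_qPoch`. -/
lemma sum_qCoef_mul_exp_nonneg (n : ℕ) (y : ℝ) (hy : 0 ≤ y) :
    0 ≤ ∑ m ∈ Finset.range (n + 1),
      qCoef t m * Real.exp (-y * t⁻¹ ^ m) / qPoch t t (n - m) := by
  induction n generalizing y with
  | zero => simp [qCoef, qPoch_zero, Real.exp_nonneg]
  | succ n ih =>
    set f : ℝ → ℝ := fun y => ∑ m ∈ Finset.range (n + 2),
      qCoef t m / qPoch t t (n + 1 - m) * Real.exp (y * (t⁻¹ ^ (n + 1) - t⁻¹ ^ m)) with hf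
    have hd : ∀ y, HasDerivAt f (t⁻¹ ^ (n + 1) * Real.exp (y * t⁻¹ ^ (n + 1)) *
        ∑ m ∈ Finset.range (n + 1),
          qCoef t m * Real.exp (-y * t⁻¹ ^ m) / qPoch t t (n - m)) y := by
      intro y
      have h2 : HasDerivAt f (∑ m ∈ Finset.range (n + 2), qCoef t m / qPoch t t (n + 1 - m) *
          (Real.exp (y * (t⁻¹ ^ (n + 1) - t⁻¹ ^ m)) * (1 * (t⁻¹ ^ (n + 1) - t⁻¹ ^ m)))) y :=
        HasDerivAt.fun_sum fun m _ =>
          (((hasDerivAt_id y).mul_const _).exp).const_mul _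
      convert! h2 using 1
      rw [Finset.sum_range_succ _ (n + 1), sub_self, mul_zero, mul_zero, mul_zero, mul_zero, add_zero,
        Finset.mul_sum]
      refine Finset.sum_congr rfl fun m hm => ?_
      have hm' : n + 1 - m = (n - m) + 1 := by have := Finset.mem_range.1 hm; omega
      have h3 : t⁻¹ ^ (n + 1) - t⁻¹ ^ m = t⁻¹ ^ (n + 1) * (1 - t ^ ((n - m) + 1)) := by
        have : t⁻¹ ^ (n + 1) = t⁻¹ ^ m * t⁻¹ ^ ((n - m) + 1) := by
          rw [← pow_add]; congr 1; omega
        rw [this, mul_assoc, mul_sub, mul_one, ← mul_pow, inv_mul_cancel₀ h0.ne', one_pow,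
          mul_sub, mul_one]
      have h4 : Real.exp (y * (t⁻¹ ^ (n + 1) - t⁻¹ ^ m))
          = Real.exp (y * t⁻¹ ^ (n + 1)) * Real.exp (-y * t⁻¹ ^ m) := by
        rw [← Real.exp_add]; congr 1; ring
      have h5 := one_sub_pow_div_qPoch_self h0 h1 (n - m)
      rw [h4, hm', div_eq_mul_one_div _ (qPoch t t (n - m)), ← h5, h3]
      ring
    have hmono : MonotoneOn f (Set.Ici 0) := by
      refine monotoneOn_of_deriv_nonneg (convex_Ici 0)
        (fun y _ => (hd y).continuousAt.continuousWithinAt)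
        (fun y _ => (hd y).differentiableAt.differentiableWithinAt) fun y hy => ?_
      rw [(hd y).deriv]
      rw [interior_Ici] at hy
      exact mul_nonneg (by positivity) (ih y (le_of_lt hy))
    have hf0 : f 0 = 0 := by
      simp only [hf, zero_mul, Real.exp_zero, mul_one]
      exact sum_qCoef_div_qPoch h0 h1 n
    have h6 : 0 ≤ f y := hf0 ▸ hmono (Set.mem_Ici.2 le_rfl) (Set.mem_Ici.2 hy) hy
    have h7 : ∑ m ∈ Finset.range (n + 1 + 1),
        qCoef t m * Real.exp (-y * t⁻¹ ^ m) / qPoch t t (n + 1 - m)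
        = Real.exp (-(y * t⁻¹ ^ (n + 1))) * f y := by
      rw [hf, Finset.mul_sum]
      refine Finset.sum_congr rfl fun m _ => ?_
      have h4 : Real.exp (-y * t⁻¹ ^ m) = Real.exp (-(y * t⁻¹ ^ (n + 1))) *
          Real.exp (y * (t⁻¹ ^ (n + 1) - t⁻¹ ^ m)) := by
        rw [← Real.exp_add]; congr 1; ring
      rw [h4]
      ring
    rw [h7]
    positivity

end QSeries

/-! ### The limit law is a probability measure. -/

/-- The cumulative distribution function of `limitLaw t χ`. -/
noncomputable def limitCdf (t χ : ℝ) (x : ℤ) : ℝ :=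
  1 / qPochInf t t * ∑' m : ℕ, qCoef t m * (t ^ m * Real.exp (-χ * t ^ (x - (m : ℤ))))

lemma limitTerm_eq (t χ : ℝ) (x : ℤ) (m : ℕ) :
    limitTerm t χ x m = qCoef t m * Real.exp (-χ * t ^ (x - (m : ℤ))) := mul_comm _ _

lemma limitProb_eq (t χ : ℝ) (x : ℤ) :
    limitProb t χ x
      = 1 / qPochInf t t * ∑' m : ℕ, qCoef t m * Real.exp (-χ * t ^ (x - (m : ℤ))) := by
  simp only [limitProb, limitTerm_eq]

lemma limitLaw_singleton (t χ : ℝ) (x : ℤ) : limitLaw t χ {x} = ENNReal.ofReal (limitProb t χ x) := by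
  rw [limitLaw, Measure.sum_apply _ (measurableSet_singleton x), tsum_eq_single x]
  · simp
  · intro y hy
    simp [hy]

section LimitLaw

variable {t χ : ℝ} (h0 : 0 < t) (h1 : t < 1) (hχ : 0 < χ)
include h0 hχ

lemma abs_exp_neg_mul_zpow_le_one (k : ℤ) : |Real.exp (-χ * t ^ k)| ≤ 1 := by
  rw [abs_of_pos (Real.exp_pos _), Real.exp_le_one_iff]
  have : 0 < t ^ k := zpow_pos h0 k
  nlinarith

include h1

lemma summable_limitTerm (x : ℤ) : Summable (limitTerm t χ x) := by
  simpa only [← limitTerm_eq] using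
    summable_qCoef_mul h0 h1 fun m => abs_exp_neg_mul_zpow_le_one h0 hχ (x - (m : ℤ))

lemma limitProb_nonneg (x : ℤ) : 0 ≤ limitProb t χ x := by
  rw [limitProb_eq]
  refine ge_of_tendsto' (tendsto_sum_qCoef_mul_div h0 h1
    fun m => abs_exp_neg_mul_zpow_le_one h0 hχ (x - (m : ℤ))) fun n => ?_
  have hy : 0 ≤ χ * t ^ x := mul_nonneg hχ.le (zpow_pos h0 x).le
  refine (sum_qCoef_mul_exp_nonneg h0 h1 n _ hy).trans_eq (Finset.sum_congr rfl fun m _ => ?_)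
  have hk : -(χ * t ^ x) * t⁻¹ ^ m = -χ * t ^ (x - (m : ℤ)) := by
    rw [zpow_sub₀ h0.ne', zpow_natCast, inv_pow]
    ring
  rw [hk]

/-- As Σ `qCoef t m` = 0, each exponential may be replaced by itself minus 1, and |e^{-u} - 1| ≤ u.
The factor t^{-m} is absorbed by the fast decay of `qCoef`. -/
lemma limitProb_le_mul_zpow (x : ℤ) :
    limitProb t χ x ≤ 1 / qPochInf t t * (∑' m, |qCoef t m| * t⁻¹ ^ m) * (χ * t ^ x) := by
  have hP := qPochInf_self_pos h0 h1
  rw [limitProb_eq, mul_assoc]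
  refine mul_le_mul_of_nonneg_left ?_ (one_div_pos.2 hP).le
  have hs := summable_qCoef_mul h0 h1 fun m => abs_exp_neg_mul_zpow_le_one h0 hχ (x - (m : ℤ))
  have hc : Summable (qCoef t) := (summable_abs_qCoef h0 h1).of_abs
  rw [← sub_zero (∑' m, _ * _), ← tsum_qCoef h0 h1, ← hs.tsum_sub hc, ← tsum_mul_right]
  have hs' := (summable_abs_qCoef_mul_pow h0 h1 t⁻¹ (inv_pos.2 h0)).mul_right (χ * t ^ x)
  refine (hs.sub hc).tsum_le_tsum (fun m => ?_) hs'
  have hk : t⁻¹ ^ m * (χ * t ^ x) = χ * t ^ (x - (m : ℤ)) := by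
    rw [zpow_sub₀ h0.ne', zpow_natCast, inv_pow]
    field_simp
  have h2 : |Real.exp (-χ * t ^ (x - (m : ℤ))) - 1| ≤ χ * t ^ (x - (m : ℤ)) := by
    have h3 := Real.add_one_le_exp (-χ * t ^ (x - (m : ℤ)))
    have h4 := (le_abs_self _).trans (abs_exp_neg_mul_zpow_le_one h0 hχ (x - (m : ℤ)))
    rw [abs_of_nonpos (by linarith)]
    linarith
  rw [mul_assoc, hk, ← mul_sub_one]
  refine (le_abs_self _).trans ?_
  rw [abs_mul]
  exact mul_le_mul_of_nonneg_left h2 (abs_nonneg _)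

lemma abs_pow_mul_exp_le_one (x : ℤ) (m : ℕ) :
    |t ^ m * Real.exp (-χ * t ^ (x - (m : ℤ)))| ≤ 1 := by
  rw [abs_mul, abs_of_pos (pow_pos h0 m)]
  exact mul_le_one₀ (pow_le_one₀ h0.le h1.le) (abs_nonneg _)
    (abs_exp_neg_mul_zpow_le_one h0 hχ _)

lemma limitCdf_sub (x : ℤ) : limitCdf t χ x - limitCdf t χ (x - 1) = limitProb t χ x := by
  rw [limitProb_eq, limitCdf, limitCdf, ← mul_sub]
  congr 1
  set G : ℕ → ℝ := fun m => Real.exp (-χ * t ^ (x - (m : ℤ))) with hG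
  have hG1 : ∀ m, |G m| ≤ 1 := fun m => abs_exp_neg_mul_zpow_le_one h0 hχ _
  have hpow : ∀ m : ℕ, |1 - t ^ m| ≤ 1 := fun m => by
    have h2 : t ^ m ≤ 1 := pow_le_one₀ h0.le h1.le
    have h3 : 0 < t ^ m := pow_pos h0 m
    rw [abs_of_nonneg (by linarith)]
    linarith
  have hS1 : Summable fun m => qCoef t m * (t ^ m * G m) :=
    summable_qCoef_mul h0 h1 fun m => abs_pow_mul_exp_le_one h0 h1 hχ x m
  have hS2 : Summable fun m => qCoef t m * ((1 - t ^ m) * G m) :=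
    summable_qCoef_mul h0 h1 (C := 1) fun m => by
      rw [abs_mul]
      exact mul_le_one₀ (hpow m) (abs_nonneg _) (hG1 m)
  -- Lowering x by 1 shifts m to m + 1 in the exponential; `qCoef_succ` turns t^m `qCoef t m` into
  -- the matching coefficient, and the new term m = 0 vanishes.
  have h4 : ∑' m : ℕ, qCoef t m * (t ^ m * Real.exp (-χ * t ^ (x - 1 - (m : ℤ))))
      = -∑' m, qCoef t m * ((1 - t ^ m) * G m) := by
    rw [hS2.tsum_eq_zero_add, pow_zero, sub_self, zero_mul, mul_zero, zero_add, ← tsum_neg]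
    refine tsum_congr fun m => ?_
    rw [← mul_assoc, ← mul_assoc, qCoef_succ h0 h1]
    have : x - 1 - (m : ℤ) = x - ((m + 1 : ℕ) : ℤ) := by push_cast; ring
    rw [this]
    ring
  rw [h4, sub_neg_eq_add, ← hS1.tsum_add hS2]
  refine tsum_congr fun m => ?_
  ring

lemma tendsto_limitCdf_nat : Tendsto (fun n : ℕ => limitCdf t χ n) atTop (𝓝 1) := by
  rw [← tsum_qCoef_mul_pow h0 h1]
  refine Tendsto.const_mul _ (tendsto_tsum_of_dominated_convergence
    (bound := fun m => |qCoef t m|) (summable_abs_qCoef h0 h1) (fun m => ?_)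
    (Eventually.of_forall fun n m => ?_))
  · have h2 : Tendsto (fun n : ℕ => Real.exp (-χ * t ^ ((n : ℤ) - (m : ℤ)))) atTop (𝓝 1) := by
      have h3 : Tendsto (fun n : ℕ => -χ * (t ^ n / t ^ m)) atTop (𝓝 (-χ * (0 / t ^ m))) :=
        ((tendsto_pow_atTop_nhds_zero_of_lt_one h0.le h1).div_const _).const_mul _
      rw [zero_div, mul_zero] at h3
      have h4 := (Real.continuous_exp.tendsto 0).comp h3
      rw [Real.exp_zero] at h4
      refine h4.congr fun n => ?_
      simp [zpow_sub₀ h0.ne']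
    simpa using (h2.const_mul (t ^ m)).const_mul (qCoef t m)
  · rw [Real.norm_eq_abs, abs_mul]
    exact mul_le_of_le_one_right (abs_nonneg _) (abs_pow_mul_exp_le_one h0 h1 hχ _ m)

lemma tendsto_limitCdf_neg_nat : Tendsto (fun n : ℕ => limitCdf t χ (-(n : ℤ))) atTop (𝓝 0) := by
  have hz : (0 : ℝ) = 1 / qPochInf t t * ∑' _ : ℕ, (0 : ℝ) := by simp
  rw [hz]
  refine Tendsto.const_mul _ (tendsto_tsum_of_dominated_convergence
    (bound := fun m => |qCoef t m|) (summable_abs_qCoef h0 h1) (fun m => ?_)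
    (Eventually.of_forall fun n m => ?_))
  · have h2 : Tendsto (fun n : ℕ => Real.exp (-χ * t ^ (-(n : ℤ) - (m : ℤ)))) atTop (𝓝 0) := by
      have h3 : Tendsto (fun n : ℕ => -(χ / t ^ m * t⁻¹ ^ n)) atTop atBot :=
        tendsto_neg_atTop_atBot.comp ((tendsto_pow_atTop_atTop_of_one_lt
          ((one_lt_inv₀ h0).2 h1)).const_mul_atTop (by positivity))
      refine (Real.tendsto_exp_atBot.comp h3).congr fun n => ?_
      simp only [Function.comp, zpow_sub₀ h0.ne', zpow_neg, zpow_natCast, inv_pow]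
      congr 1
      ring
    simpa using (h2.const_mul (t ^ m)).const_mul (qCoef t m)
  · rw [Real.norm_eq_abs, abs_mul]
    exact mul_le_of_le_one_right (abs_nonneg _) (abs_pow_mul_exp_le_one h0 h1 hχ _ m)

lemma hasSum_limitProb : HasSum (limitProb t χ) 1 := by
  have hnn := limitProb_nonneg h0 h1 hχ
  have hA : HasSum (fun n : ℕ => limitProb t χ n) (1 - limitCdf t χ (-1)) := by
    rw [hasSum_iff_tendsto_nat_of_nonneg fun n => hnn _]
    refine (tendsto_add_atTop_iff_nat 1).1 (((tendsto_limitCdf_nat h0 h1 hχ).sub_const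
      (limitCdf t χ (-1))).congr fun k => ?_)
    induction k with
    | zero => simp [← limitCdf_sub h0 h1 hχ]
    | succ k ih =>
      rw [Finset.sum_range_succ, ← ih, ← limitCdf_sub h0 h1 hχ]
      push_cast
      rw [add_sub_cancel_right]
      ring
  have hB : HasSum (fun n : ℕ => limitProb t χ (-((n : ℤ) + 1))) (limitCdf t χ (-1) - 0) := by
    rw [hasSum_iff_tendsto_nat_of_nonneg fun n => hnn _]
    refine (((tendsto_limitCdf_neg_nat h0 h1 hχ).comp (tendsto_add_atTop_nat 1)).const_sub
      (limitCdf t χ (-1))).congr fun n => ?_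
    simp only [Function.comp]
    induction n with
    | zero => simp
    | succ n ih =>
      rw [Finset.sum_range_succ, ← ih, ← limitCdf_sub h0 h1 hχ]
      push_cast
      rw [show -((n : ℤ) + 1) - 1 = -((n : ℤ) + 1 + 1) by ring]
      ring
  simpa using hA.of_nat_of_neg_add_one hB

lemma limitLaw_real_singleton (x : ℤ) : (limitLaw t χ).real {x} = limitProb t χ x := by
  rw [measureReal_def, limitLaw_singleton,
    ENNReal.toReal_ofReal (limitProb_nonneg h0 h1 hχ x)]

lemma isProbabilityMeasure_limitLaw : IsProbabilityMeasure (limitLaw t χ) := by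
  refine ⟨?_⟩
  rw [limitLaw, Measure.sum_apply _ MeasurableSet.univ]
  have h := hasSum_limitProb h0 h1 hχ
  simp only [Measure.smul_apply, Measure.dirac_apply_of_mem (Set.mem_univ _), smul_eq_mul, mul_one]
  rw [← ENNReal.ofReal_tsum_of_nonneg (limitProb_nonneg h0 h1 hχ) h.summable, h.tsum_eq,
    ENNReal.ofReal_one]

end LimitLaw

/-! ### Counting independent tuples over 𝔽_p. -/

/-- The probability that a uniform `R × d` matrix over the field with `t⁻¹` elements has linearly
independent columns. -/
noncomputable def injProb (t : ℝ) (R d : ℕ) : ℝ :=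
  if d ≤ R then qPoch t t R / qPoch t t (R - d) else 0

/-- For r = R + n the sum is (t;t)_r times the sum of `sum_qCoef_div_qPoch`, so only n = 0 survives;
for r < R every term is 0. -/
lemma sum_qCoef_mul_injProb {t : ℝ} (h0 : 0 < t) (h1 : t < 1) {r R N : ℕ} (hr : r ≤ N) :
    ∑ m ∈ Finset.range (N - R + 1), qCoef t m * injProb t r (R + m)
      = if r = R then qPoch t t R else 0 := by
  rcases lt_or_ge r R with hlt | hge
  · rw [if_neg hlt.ne]
    refine Finset.sum_eq_zero fun m _ => ?_
    rw [injProb, if_neg (by omega), mul_zero]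
  · obtain ⟨n, rfl⟩ := Nat.exists_eq_add_of_le hge
    have hsub : Finset.range (n + 1) ⊆ Finset.range (N - R + 1) :=
      Finset.range_subset_range.2 (by omega)
    rw [← Finset.sum_subset hsub fun m _ hm => ?_]
    · have h2 : ∀ m ∈ Finset.range (n + 1), qCoef t m * injProb t (R + n) (R + m)
          = qPoch t t (R + n) * (qCoef t m / qPoch t t (n - m)) := fun m hm => by
        have := Finset.mem_range.1 hm
        rw [injProb, if_pos (by omega), Nat.add_sub_add_left]
        ring
      rw [Finset.sum_congr rfl h2, ← Finset.mul_sum]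
      cases n with
      | zero => simp [qCoef, qPoch_zero]
      | succ n => rw [sum_qCoef_div_qPoch h0 h1, if_neg (by omega), mul_zero]
    · have : ¬ m < n + 1 := fun h => hm (Finset.mem_range.2 h)
      rw [injProb, if_neg (by omega), mul_zero]

lemma prod_one_sub_pow_eq_div {t : ℝ} (h0 : 0 < t) (h1 : t < 1) {R d : ℕ} (h : d ≤ R) :
    ∏ i ∈ Finset.range d, (1 - t ^ (R - i)) = qPoch t t R / qPoch t t (R - d) := by
  induction d with
  | zero => simp [div_self (qPoch_self_ne h0 h1 R)]
  | succ d ih =>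
    rw [Finset.prod_range_succ, ih (by omega)]
    have h2 : R - d = (R - (d + 1)) + 1 := by omega
    have h3 := one_sub_pow_div_qPoch_self h0 h1 (R - (d + 1))
    rw [h2, div_mul_eq_mul_div, mul_div_assoc, h3, mul_one_div]

/-- All fibres of a surjective homomorphism have the same size, so it carries the uniform law to the
uniform law. -/
lemma card_subtype_comp_div {G H : Type*} [AddGroup G] [AddGroup H] [Finite G] [Finite H]
    (f : G →+ H) (hf : Function.Surjective f) (S : H → Prop) :
    (Nat.card {g // S (f g)} : ℝ) / Nat.card G = Nat.card {h // S h} / Nat.card H := by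
  classical
  have := Fintype.ofFinite G
  have := Fintype.ofFinite H
  have hfib : ∀ h : H, Finset.card {g | f g = h} = Finset.card {g | f g = 0} := fun h =>
    AddMonoidHom.card_fiber_eq_of_mem_range f (hf h) (hf 0)
  have hG : Nat.card G = Nat.card H * Finset.card {g | f g = 0} := by
    rw [Nat.card_eq_fintype_card, Nat.card_eq_fintype_card, ← Finset.card_univ,
      Finset.card_eq_sum_card_fiberwise (f := f) (t := Finset.univ) (by simp),
      Finset.sum_congr rfl fun h _ => hfib h, Finset.sum_const, smul_eq_mul, Finset.card_univ]
  have hS : Nat.card {g // S (f g)} = Nat.card {h // S h} * Finset.card {g | f g = 0} := by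
    rw [Nat.card_eq_fintype_card, Nat.card_eq_fintype_card, Fintype.card_subtype,
      Fintype.card_subtype, Finset.card_eq_sum_card_fiberwise (f := f) (t := {h | S h})
        (fun g hg => by simpa using hg), ← smul_eq_mul, ← Finset.sum_const]
    refine Finset.sum_congr rfl fun h hh => ?_
    rw [← hfib h]
    congr 1
    ext g
    simp only [Finset.mem_filter, Finset.mem_univ, true_and] at hh ⊢
    exact ⟨fun hg => hg.2, fun hg => ⟨hg ▸ hh, hg⟩⟩
  have hpos : (Finset.card {g | f g = 0} : ℝ) ≠ 0 := by
    rw [Nat.cast_ne_zero]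
    exact (Finset.card_pos.2 ⟨0, by simp⟩).ne'
  rw [hG, hS]
  push_cast
  rw [mul_div_mul_right _ _ hpos]

section Counting

variable (p : ℕ) [Fact p.Prime]

lemma inv_prime_pos : 0 < (p : ℝ)⁻¹ := inv_pos.2 (by exact_mod_cast (Fact.out : p.Prime).pos)

lemma inv_prime_lt_one : (p : ℝ)⁻¹ < 1 :=
  inv_lt_one_of_one_lt₀ (by exact_mod_cast (Fact.out : p.Prime).one_lt)

variable {p}

lemma card_linearIndependent_div {W : Type*} [AddCommGroup W] [Module (ZMod p) W] [Finite W]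
    (d : ℕ) :
    (Nat.card {b : Fin d → W // LinearIndependent (ZMod p) b} : ℝ) / Nat.card (Fin d → W)
      = injProb (p : ℝ)⁻¹ (Module.finrank (ZMod p) W) d := by
  have := Fintype.ofFinite W
  set R := Module.finrank (ZMod p) W with hR
  have hp0 : (p : ℝ) ≠ 0 := by exact_mod_cast (Fact.out : p.Prime).ne_zero
  rw [injProb]
  split_ifs with h
  · have hW : Nat.card (Fin d → W) = (p ^ R) ^ d := by
      rw [Nat.card_fun, Nat.card_fin, Module.natCard_eq_pow_finrank (K := ZMod p), Nat.card_zmod]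
    rw [hW, card_linearIndependent h, ZMod.card,
      ← prod_one_sub_pow_eq_div (inv_prime_pos p) (inv_prime_lt_one p) h,
      Finset.prod_range (fun i => 1 - (p : ℝ)⁻¹ ^ (R - i))]
    push_cast
    rw [← Fin.prod_const d ((p : ℝ) ^ R), ← Finset.prod_div_distrib]
    refine Finset.prod_congr rfl fun i _ => ?_
    have hi : (i : ℕ) ≤ R := by omega
    rw [Nat.cast_sub (Nat.pow_le_pow_right (Fact.out : p.Prime).pos hi)]
    push_cast
    rw [sub_div, div_self (pow_ne_zero _ hp0), inv_pow, ← pow_sub_mul_pow (p : ℝ) hi]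
    field_simp
  · have : IsEmpty {b : Fin d → W // LinearIndependent (ZMod p) b} :=
      ⟨fun b => h (by simpa using b.2.fintype_card_le_finrank)⟩
    simp

lemma card_linearIndependent_mulVec_div {N : ℕ} (M : Matrix (Fin N) (Fin N) (ZMod p)) (d : ℕ) :
    (Nat.card {b : Fin d → Fin N → ZMod p // LinearIndependent (ZMod p) fun i => M.mulVec (b i)} : ℝ)
        / Nat.card (Fin d → Fin N → ZMod p)
      = injProb (p : ℝ)⁻¹ M.rank d := by
  let W := LinearMap.range M.mulVecLin
  let f : (Fin d → Fin N → ZMod p) →+ (Fin d → W) :=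
    { toFun := fun b i => M.mulVecLin.rangeRestrict (b i)
      map_zero' := by ext1; simp
      map_add' := fun a b => by ext1; simp }
  have hf : Function.Surjective f := fun w => by
    choose b hb using fun i => M.mulVecLin.surjective_rangeRestrict (w i)
    exact ⟨b, funext hb⟩
  have h := card_subtype_comp_div f hf fun w => LinearIndependent (ZMod p) w
  rw [card_linearIndependent_div] at h
  have hcard : Nat.card {b : Fin d → Fin N → ZMod p //
      LinearIndependent (ZMod p) fun i => M.mulVec (b i)}
      = Nat.card {b // LinearIndependent (ZMod p) (f b)} :=
    Nat.card_congr (Equiv.subtypeEquivRight fun b =>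
      LinearMap.linearIndependent_iff W.subtype (v := f b) (by simp))
  rw [Matrix.rank, ← h, hcard]

lemma card_mulVec_linearIndependent_div {N d : ℕ} {b : Fin d → Fin N → ZMod p}
    (hb : LinearIndependent (ZMod p) b) :
    (Nat.card {A : Matrix (Fin N) (Fin N) (ZMod p) //
        LinearIndependent (ZMod p) fun i => A.mulVec (b i)} : ℝ)
        / Nat.card (Matrix (Fin N) (Fin N) (ZMod p))
      = injProb (p : ℝ)⁻¹ N d := by
  let f : Matrix (Fin N) (Fin N) (ZMod p) →+ (Fin d → Fin N → ZMod p) :=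
    { toFun := fun A i => A.mulVec (b i)
      map_zero' := by ext1; simp
      map_add' := fun a b => by ext1; simp [Matrix.add_mulVec] }
  have hf : Function.Surjective f := fun w => by
    -- A left inverse g of the combination map of b reads off coordinates, so w ∘ g is a linear map
    -- with b i ↦ w i.
    obtain ⟨g, hg⟩ := (Fintype.linearCombination (ZMod p) b).exists_leftInverse_of_injective
      (LinearMap.ker_eq_bot.2 (linearIndependent_iff_injective_fintypeLinearCombination.1 hb))
    refine ⟨LinearMap.toMatrix' (Fintype.linearCombination (ZMod p) w ∘ₗ g), funext fun i => ?_⟩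
    have h2 := LinearMap.congr_fun hg (Pi.single i 1)
    simp only [LinearMap.comp_apply, Fintype.linearCombination_apply_single, one_smul,
      LinearMap.id_apply] at h2
    change (LinearMap.toMatrix' _).mulVec (b i) = w i
    rw [LinearMap.toMatrix'_mulVec, LinearMap.comp_apply, h2,
      Fintype.linearCombination_apply_single, one_smul]
  have h := card_subtype_comp_div f hf fun w => LinearIndependent (ZMod p) w
  rw [card_linearIndependent_div, Module.finrank_fin_fun] at h
  exact h

end Counting

/-! ### Exact law of the rank of the product. -/

section Law

lemma measureReal_prod_mem_of_indepFun {Ω α β : Type*} [MeasurableSpace Ω] {P : Measure Ω}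
    [IsProbabilityMeasure P] [MeasurableSpace α] [DiscreteMeasurableSpace α] [Fintype α]
    [MeasurableSpace β] [DiscreteMeasurableSpace β] [Finite β] {X : Ω → α} {Y : Ω → β}
    (hX : AEMeasurable X P) (hXY : IndepFun X Y P) (hY : HasLaw Y (uniformOn Set.univ) P)
    (E : α → β → Prop) :
    P.real {ω | E (X ω) (Y ω)}
      = ∑ a, P.real {ω | X ω = a} * ((Nat.card {b // E a b} : ℝ) / Nat.card β) := by
  have hYm := hY.aemeasurable
  have := Fintype.ofFinite β
  have hm := (indepFun_iff_map_prod_eq_prod_map_map hX hYm).1 hXY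
  have h1 : P.real {ω | E (X ω) (Y ω)}
      = (P.map fun ω => (X ω, Y ω)).real {z | E z.1 z.2} := by
    rw [map_measureReal_apply_of_aemeasurable (hX.prodMk hYm) (Set.toFinite _).measurableSet]
    rfl
  have := Measure.isProbabilityMeasure_map (μ := P) hYm
  have := Measure.isProbabilityMeasure_map (μ := P) hX
  rw [h1, hm, measureReal_def, Measure.prod_apply (Set.toFinite _).measurableSet,
    lintegral_fintype, ENNReal.toReal_sum fun a _ => ENNReal.mul_ne_top (measure_ne_top _ _)
      (measure_ne_top _ _)]
  refine Finset.sum_congr rfl fun a _ => ?_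
  rw [ENNReal.toReal_mul, mul_comm, ← measureReal_def, ← measureReal_def,
    map_measureReal_apply_of_aemeasurable hX (Set.toFinite _).measurableSet, hY.map_eq]
  congr 1
  rw [measureReal_def, uniformOn_univ, ENNReal.toReal_div,
    Measure.count_apply_finite _ (Set.toFinite _), ENNReal.toReal_natCast,
    Nat.card_eq_fintype_card (α := β), ← Set.ncard_eq_toFinset_card _ (Set.toFinite _),
    ← Nat.card_coe_set_eq]
  rfl

instance matModDiscreteMeasurableSpace (p N : ℕ) :
    DiscreteMeasurableSpace (Matrix (Fin N) (Fin N) (ZMod p)) := ⟨fun _ => trivial⟩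

variable {p : ℕ} [Fact p.Prime] {N : ℕ} {Ω : Type*} [MeasurableSpace Ω] {P : Measure Ω}
  {A : ℕ → Ω → Matrix (Fin N) (Fin N) (ZMod p)}

lemma leftProd_congr {R : Type*} [Semiring R] {B C : ℕ → Matrix (Fin N) (Fin N) R} {s : ℕ}
    (h : ∀ i < s, B i = C i) : leftProd B s = leftProd C s := by
  induction s with
  | zero => rfl
  | succ s ih => rw [leftProd, leftProd, h s (by omega), ih fun i hi => h i (by omega)]

lemma aemeasurable_leftProd (hA : ∀ i, AEMeasurable (A i) P) (s : ℕ) :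
    AEMeasurable (fun ω => leftProd (fun i => A i ω) s) P := by
  induction s with
  | zero => exact aemeasurable_const
  | succ s ih =>
    exact (Measurable.of_discrete (f := fun z : Matrix (Fin N) (Fin N) (ZMod p) ×
      Matrix (Fin N) (Fin N) (ZMod p) => z.1 * z.2)).comp_aemeasurable ((hA s).prodMk ih)

lemma indepFun_leftProd (hindep : iIndepFun A P) (hA : ∀ i, AEMeasurable (A i) P) (s : ℕ) :
    IndepFun (fun ω => leftProd (fun i => A i ω) s) (A s) P := by
  have h := hindep.indepFun_finset₀ (Finset.range s) {s} (by simp) hA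
  have h2 := h.comp
    -- The default 0 outside the range is never read: the product uses only indices below s.
    (φ := fun a => leftProd (fun i => if h : i ∈ Finset.range s then a ⟨i, h⟩ else 0) s)
    (ψ := fun a => a ⟨s, Finset.mem_singleton_self s⟩)
    Measurable.of_discrete Measurable.of_discrete
  convert! h2 using 1
  funext ω
  exact leftProd_congr fun i hi => by simp [hi]

variable [IsProbabilityMeasure P]

/-- Condition on the product C of the first s factors: if the vectors C b_j are independent, the
next factor makes them a uniform tuple; if dependent, they stay so. -/
lemma measureReal_linearIndependent_leftProd (hindep : iIndepFun A P)
    (hunif : ∀ i, HasLaw (A i) (uniformOn Set.univ) P) (s : ℕ) {d : ℕ}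
    {b : Fin d → Fin N → ZMod p} (hb : LinearIndependent (ZMod p) b) :
    P.real {ω | LinearIndependent (ZMod p) fun j =>
      (leftProd (fun i => A i ω) s).mulVec (b j)} = injProb (p : ℝ)⁻¹ N d ^ s := by
  classical
  have hA : ∀ i, AEMeasurable (A i) P := fun i => (hunif i).aemeasurable
  induction s with
  | zero => simp [leftProd, hb]
  | succ s ih =>
    have h1 := measureReal_prod_mem_of_indepFun (aemeasurable_leftProd hA s)
      (indepFun_leftProd hindep hA s) (hunif s)
      (fun C B => LinearIndependent (ZMod p) fun j => (B * C).mulVec (b j))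
    have h2 := measureReal_prod_mem_of_indepFun (aemeasurable_leftProd hA s)
      (indepFun_leftProd hindep hA s) (hunif s)
      (fun C _ => LinearIndependent (ZMod p) fun j => C.mulVec (b j))
    rw [ih] at h2
    simp only [leftProd]
    rw [h1, pow_succ, h2, Finset.sum_mul]
    refine Finset.sum_congr rfl fun C _ => ?_
    rw [mul_assoc]
    congr 1
    simp only [← Matrix.mulVec_mulVec]
    by_cases hC : LinearIndependent (ZMod p) fun j => C.mulVec (b j)
    · rw [card_mulVec_linearIndependent_div hC]
      simp [hC]
    · have : ∀ B : Matrix (Fin N) (Fin N) (ZMod p),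
          ¬ LinearIndependent (ZMod p) fun j => B.mulVec (C.mulVec (b j)) := fun B hB =>
        hC (LinearIndependent.of_comp B.mulVecLin hB)
      simp only [hC, this, Nat.card_of_isEmpty, Nat.cast_zero, zero_div, zero_mul]

lemma measureReal_comp_eq_sum {α : Type*} [MeasurableSpace α] [DiscreteMeasurableSpace α]
    [Fintype α] {X : Ω → α} (hX : AEMeasurable X P) (E : α → Prop) [DecidablePred E] :
    P.real {ω | E (X ω)} = ∑ a, P.real {ω | X ω = a} * if E a then 1 else 0 := by
  have h1 : ∀ S : Set α, P.real {ω | X ω ∈ S} = (P.map X).real S := fun S =>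
    (map_measureReal_apply_of_aemeasurable hX (Set.toFinite S).measurableSet).symm
  have := Measure.isProbabilityMeasure_map (μ := P) hX
  have h2 : ∀ a, P.real {ω | X ω = a} = (P.map X).real {a} := fun a => h1 {a}
  simp only [h2, mul_ite, mul_one, mul_zero]
  rw [← Finset.sum_filter, sum_measureReal_singleton, ← h1]
  simp

/-- Average over both C and a uniform tuple b. Averaging over b with C fixed gives the left side;
averaging over C with b fixed gives `injProb` to the power s for independent b, and b is independent
with probability `injProb`, whence s + 1. -/
lemma sum_measureReal_leftProd_mul_injProb (hindep : iIndepFun A P)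
    (hunif : ∀ i, HasLaw (A i) (uniformOn Set.univ) P) (s d : ℕ) :
    ∑ C, P.real {ω | leftProd (fun i => A i ω) s = C} * injProb (p : ℝ)⁻¹ C.rank d
      = injProb (p : ℝ)⁻¹ N d ^ (s + 1) := by
  classical
  have hA : ∀ i, AEMeasurable (A i) P := fun i => (hunif i).aemeasurable
  have h1 : ∀ b : Fin d → Fin N → ZMod p,
      ∑ C, P.real {ω | leftProd (fun i => A i ω) s = C} *
        (if LinearIndependent (ZMod p) fun j => C.mulVec (b j) then 1 else 0)
        = injProb (p : ℝ)⁻¹ N d ^ s * if LinearIndependent (ZMod p) b then 1 else 0 := by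
    intro b
    split_ifs with hb
    · rw [mul_one, ← measureReal_linearIndependent_leftProd hindep hunif s hb]
      exact (measureReal_comp_eq_sum (aemeasurable_leftProd hA s)
        fun C => LinearIndependent (ZMod p) fun j => C.mulVec (b j)).symm
    · rw [mul_zero]
      refine Finset.sum_eq_zero fun C _ => ?_
      have hC : ¬ LinearIndependent (ZMod p) fun j => C.mulVec (b j) := fun hC =>
        hb (LinearIndependent.of_comp C.mulVecLin hC)
      rw [if_neg hC, mul_zero]
  have h2 := Finset.sum_congr (rfl : (Finset.univ : Finset (Fin d → Fin N → ZMod p)) = _)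
    fun b _ => h1 b
  rw [Finset.sum_comm, ← Finset.mul_sum] at h2
  simp only [← Finset.mul_sum, Finset.sum_boole, ← Fintype.card_subtype,
    ← Nat.card_eq_fintype_card] at h2
  have hne : (Nat.card (Fin d → Fin N → ZMod p) : ℝ) ≠ 0 := by
    rw [Nat.cast_ne_zero]; exact Nat.card_pos.ne'
  have h3 := card_linearIndependent_div (p := p) (W := Fin N → ZMod p) d
  rw [Module.finrank_fin_fun] at h3
  rw [pow_succ]
  nth_rewrite 2 [← h3]
  rw [← mul_div_assoc, ← h2, Finset.sum_div]
  refine Finset.sum_congr rfl fun C _ => ?_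
  rw [mul_div_assoc, card_linearIndependent_mulVec_div]

lemma measureReal_rank_leftProd_eq (hindep : iIndepFun A P)
    (hunif : ∀ i, HasLaw (A i) (uniformOn Set.univ) P) (s R : ℕ) :
    P.real {ω | (leftProd (fun i => A i ω) s).rank = R}
      = 1 / qPoch (p : ℝ)⁻¹ (p : ℝ)⁻¹ R * ∑ m ∈ Finset.range (N - R + 1),
          qCoef (p : ℝ)⁻¹ m * injProb (p : ℝ)⁻¹ N (R + m) ^ (s + 1) := by
  have h0 := inv_prime_pos p
  have h1 := inv_prime_lt_one p
  have hA : ∀ i, AEMeasurable (A i) P := fun i => (hunif i).aemeasurable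
  rw [measureReal_comp_eq_sum (aemeasurable_leftProd hA s) fun C => C.rank = R]
  simp only [← sum_measureReal_leftProd_mul_injProb hindep hunif s, Finset.mul_sum]
  rw [Finset.sum_comm]
  refine Finset.sum_congr rfl fun C _ => ?_
  have h2 := sum_qCoef_mul_injProb h0 h1 (R := R) (r := C.rank) (N := N)
    (by simpa using C.rank_le_width)
  have h3 : (if C.rank = R then (1 : ℝ) else 0) = 1 / qPoch (p : ℝ)⁻¹ (p : ℝ)⁻¹ R *
      ∑ m ∈ Finset.range (N - R + 1), qCoef (p : ℝ)⁻¹ m * injProb (p : ℝ)⁻¹ C.rank (R + m) := by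
    rw [h2]
    split_ifs
    · rw [one_div, inv_mul_cancel₀ (qPoch_self_ne h0 h1 R)]
    · rw [mul_zero]
  rw [h3, Finset.mul_sum, Finset.mul_sum]
  refine Finset.sum_congr rfl fun m _ => ?_
  ring

end Law

/-! ### Uniform comparison of the exact formula with the limit. -/

section Asymptotics

variable {t : ℝ} (h0 : 0 < t) (h1 : t < 1)
include h0 h1

lemma qPoch_self_div_le_exp (j n : ℕ) :
    qPoch t t (j + n) / qPoch t t j ≤ Real.exp (-(t / (1 - t) * (t ^ j - t ^ (j + n)))) := by
  have h2 : 1 - t ≠ 0 := by linarith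
  induction n with
  | zero => simp [div_self (qPoch_self_ne h0 h1 j)]
  | succ n ih =>
    have h3 : t ^ (j + n + 1) < 1 := pow_lt_one₀ h0.le h1 (by omega)
    rw [← add_assoc, qPoch_self_succ, mul_div_right_comm]
    refine (mul_le_mul ih (Real.one_sub_le_exp_neg _) (by linarith) (Real.exp_pos _).le).trans_eq ?_
    rw [← Real.exp_add]
    congr 1
    field_simp
    ring

lemma exp_le_qPoch_self_div (j n : ℕ) :
    Real.exp (-(t / (1 - t) * (t ^ j - t ^ (j + n))
        + t ^ 2 / ((1 - t ^ 2) * (1 - t)) * ((t ^ j) ^ 2 - (t ^ (j + n)) ^ 2)))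
      ≤ qPoch t t (j + n) / qPoch t t j := by
  have h2 : 0 < 1 - t := by linarith
  have h2' : 1 - t ^ 2 ≠ 0 := by nlinarith
  induction n with
  | zero => simp [div_self (qPoch_self_ne h0 h1 j)]
  | succ n ih =>
    set u := t ^ (j + n + 1) with hu
    have hu0 : 0 < u := pow_pos h0 _
    have hut : u ≤ t := pow_le_of_le_one h0.le h1.le (by omega)
    have hu1 : 0 < 1 - u := by linarith
    have h3 : Real.exp (-(u + u ^ 2 / (1 - t))) ≤ 1 - u := by
      rw [← Real.le_log_iff_exp_le hu1]
      -- First-order Taylor bound |u + log(1-u)| ≤ u²/(1-u); the quadratic errors sum to the second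
      -- geometric term of the exponent.
      have h4 := Real.abs_log_sub_add_sum_range_le (x := u) (by rw [abs_of_pos hu0]; linarith) 1
      simp only [Finset.sum_range_one, abs_of_pos hu0] at h4
      norm_num at h4
      have h5 := (abs_le.1 h4).1
      have h6 : u ^ 2 / (1 - u) ≤ u ^ 2 / (1 - t) := by gcongr
      linarith
    rw [← add_assoc, qPoch_self_succ, mul_div_right_comm]
    refine le_trans (le_of_eq ?_) (mul_le_mul ih h3 (Real.exp_pos _).le
      (div_pos (qPoch_self_pos h0 h1 _) (qPoch_self_pos h0 h1 _)).le)
    rw [← Real.exp_add]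
    congr 1
    rw [← hu]
    have hut : u = t ^ (j + n) * t := pow_succ _ _
    rw [hut]
    field_simp
    ring

/-- The constant of the uniform comparison between `((t;t)_N / (t;t)_j)^{s+1}` and its exponential
approximation. -/
noncomputable def survivalConst (t : ℝ) : ℝ :=
  1 + 4 * (t ^ 2 / ((1 - t ^ 2) * (1 - t))) / (t / (1 - t)) ^ 2 + 1 / (t / (1 - t))

/-- With c = t/(1-t) and v = s c t^j, the relative error of the lower bound is a multiple of (v +
v²)/s. Since v e^{-v} ≤ 1 and v² e^{-v} ≤ 2, the absolute error is O(1/s) uniformly in j. -/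
lemma abs_div_pow_sub_exp_le {s : ℕ} (hs : 1 ≤ s) (j n : ℕ) :
    |(qPoch t t (j + n) / qPoch t t j) ^ (s + 1) - Real.exp (-(s * (t / (1 - t)) * t ^ j))|
      ≤ survivalConst t / s + (Real.exp (s * (t / (1 - t)) * t ^ (j + n)) - 1) := by
  have h2 : 0 < 1 - t := by linarith
  have h2' : 0 < 1 - t ^ 2 := by nlinarith
  have hs' : (1 : ℝ) ≤ s := by exact_mod_cast hs
  have hup := qPoch_self_div_le_exp h0 h1 j n
  have hlo := exp_le_qPoch_self_div h0 h1 j n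
  have hrho : 0 < qPoch t t (j + n) / qPoch t t j :=
    div_pos (qPoch_self_pos h0 h1 _) (qPoch_self_pos h0 h1 _)
  have hrho1 : qPoch t t (j + n) / qPoch t t j ≤ 1 :=
    div_le_one_of_le₀ (qPoch_self_antitone h0 h1 (by omega)) (qPoch_self_pos h0 h1 _).le
  have hconst : survivalConst t = 1 + 4 * (t ^ 2 / ((1 - t ^ 2) * (1 - t))) / (t / (1 - t)) ^ 2
    + 1 / (t / (1 - t)) := rfl
  set ρ := qPoch t t (j + n) / qPoch t t j
  set c := t / (1 - t) with hc
  set b := t ^ 2 / ((1 - t ^ 2) * (1 - t)) with hb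
  have hc0 : 0 < c := by positivity
  have hb0 : 0 < b := by positivity
  have hj : 0 < t ^ j := pow_pos h0 j
  have hjn : 0 < t ^ (j + n) := pow_pos h0 _
  set v := s * c * t ^ j with hv
  have hv0 : 0 < v := by positivity
  have hexp1 : Real.exp (-v) ≤ 1 := Real.exp_le_one_iff.2 (by linarith)
  have hε : 1 ≤ Real.exp (s * c * t ^ (j + n)) := Real.one_le_exp (by positivity)
  have hcpos : 0 ≤ survivalConst t / s := by rw [hconst]; positivity
  rw [abs_le]
  constructor
  · have h3 : Real.exp (-v) * (1 - (c * t ^ j + (s + 1) * b * (t ^ j) ^ 2)) ≤ ρ ^ (s + 1) := by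
      calc Real.exp (-v) * (1 - (c * t ^ j + (s + 1) * b * (t ^ j) ^ 2))
          ≤ Real.exp (-v) * Real.exp (-(c * t ^ j + (s + 1) * b * (t ^ j) ^ 2)) := by
            gcongr
            exact Real.one_sub_le_exp_neg _
        _ = Real.exp (-(c * t ^ j + b * (t ^ j) ^ 2)) ^ (s + 1) := by
            rw [← Real.exp_add, ← Real.exp_nat_mul]
            congr 1
            push_cast
            rw [hv]
            ring
        _ ≤ ρ ^ (s + 1) := by
            gcongr
            refine le_trans (Real.exp_le_exp.2 ?_) hlo
            have h4 : 0 ≤ c * t ^ (j + n) := by positivity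
            have h5 : 0 ≤ b * (t ^ (j + n)) ^ 2 := by positivity
            linarith
    have h4 : v * Real.exp (-v) ≤ 1 := by
      rw [Real.exp_neg, ← div_eq_mul_inv, div_le_one (Real.exp_pos _)]
      linarith [Real.add_one_le_exp v]
    have h5 : v ^ 2 * Real.exp (-v) ≤ 2 := by
      rw [Real.exp_neg, ← div_eq_mul_inv, div_le_iff₀ (Real.exp_pos _)]
      linarith [Real.quadratic_le_exp_of_nonneg hv0.le]
    have h6 : Real.exp (-v) * (c * t ^ j + (s + 1) * b * (t ^ j) ^ 2) ≤ survivalConst t / s := by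
      calc Real.exp (-v) * (c * t ^ j + (s + 1) * b * (t ^ j) ^ 2)
          ≤ Real.exp (-v) * (c * t ^ j + (s + s) * b * (t ^ j) ^ 2) := by gcongr
        _ = (v * Real.exp (-v) + 2 * b / c ^ 2 * (v ^ 2 * Real.exp (-v))) / s := by
            rw [hv]
            field_simp
            ring
        _ ≤ (1 + 2 * b / c ^ 2 * 2) / s := by gcongr
        _ ≤ survivalConst t / s := by
            rw [hconst]
            refine div_le_div_of_nonneg_right ?_ (by linarith)
            have : 0 < 1 / c := by positivity
            have h7 : 2 * b / c ^ 2 * 2 = 4 * b / c ^ 2 := by ring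
            linarith
    linarith
  · have h3 : ρ ^ (s + 1) ≤ Real.exp (-v) * Real.exp (s * c * t ^ (j + n)) := by
      calc ρ ^ (s + 1) ≤ ρ ^ s := pow_le_pow_of_le_one hrho.le hrho1 (by omega)
        _ ≤ Real.exp (-(c * (t ^ j - t ^ (j + n)))) ^ s := by gcongr
        _ = _ := by
            rw [← Real.exp_add, ← Real.exp_nat_mul]
            congr 1
            rw [hv]
            ring
    nlinarith

/-- Bounds the terms m > K of the limit series, which have no counterpart in the finite formula. -/
lemma exp_neg_zpow_le {s : ℕ} (hs : 1 ≤ s) {k : ℤ} (hk : k < 0) :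
    Real.exp (-(s * (t / (1 - t)) * t ^ k)) ≤ survivalConst t / s := by
  have h2 : 0 < 1 - t := by linarith
  have h2' : 0 < 1 - t ^ 2 := by nlinarith
  have hs' : (0 : ℝ) < s := by exact_mod_cast hs
  have hc0 : 0 < t / (1 - t) := by positivity
  have h3 : 1 ≤ t ^ k := one_le_zpow_of_nonpos₀ h0 h1.le hk.le
  calc Real.exp (-(s * (t / (1 - t)) * t ^ k)) ≤ Real.exp (-(s * (t / (1 - t)))) := by
        rw [Real.exp_le_exp]
        have : 0 < s * (t / (1 - t)) := by positivity
        nlinarith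
    _ ≤ 1 / (s * (t / (1 - t))) := by
        rw [Real.exp_neg, ← one_div]
        refine one_div_le_one_div_of_le (by positivity) ?_
        linarith [Real.add_one_le_exp (s * (t / (1 - t)))]
    _ = 1 / (t / (1 - t)) / s := by field_simp
    _ ≤ survivalConst t / s := by
        unfold survivalConst
        gcongr
        have : 0 < 4 * (t ^ 2 / ((1 - t ^ 2) * (1 - t))) / (t / (1 - t)) ^ 2 := by positivity
        linarith

lemma survivalConst_nonneg : 0 ≤ survivalConst t := by
  have h2 : 0 < 1 - t := by linarith
  have h2' : 0 < 1 - t ^ 2 := by nlinarith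
  unfold survivalConst
  positivity

lemma limitProb_le_one {χ : ℝ} (hχ : 0 < χ) (x : ℤ) : limitProb t χ x ≤ 1 :=
  le_hasSum (hasSum_limitProb h0 h1 hχ) x fun y _ => limitProb_nonneg h0 h1 hχ y

/-- For x < 0 the probability is at most 1 and t^{M-x} ≤ t^M; for x ≥ 0 its decay like t^x cancels
t^{-x}. With M = N - L the bound becomes a multiple of s t^N. -/
lemma zpow_mul_limitProb_le {χ : ℝ} (hχ : t / (1 - t) ≤ χ) (M x : ℤ) :
    t ^ (M - x) * limitProb t χ x
      ≤ (1 / (t / (1 - t)) + 1 / qPochInf t t * ∑' m, |qCoef t m| * t⁻¹ ^ m) * (χ * t ^ M) := by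
  have h2 : 0 < 1 - t := by linarith
  have hc0 : 0 < t / (1 - t) := by positivity
  have hχ0 : 0 < χ := hc0.trans_le hχ
  have hM : 0 < t ^ M := zpow_pos h0 M
  have hP := qPochInf_self_pos h0 h1
  have hB : 0 ≤ 1 / qPochInf t t * ∑' m, |qCoef t m| * t⁻¹ ^ m :=
    mul_nonneg (one_div_pos.2 hP).le (tsum_nonneg fun m => by positivity)
  rcases lt_or_ge x 0 with hx | hx
  · calc t ^ (M - x) * limitProb t χ x ≤ t ^ M * 1 := by
          refine mul_le_mul ?_ (limitProb_le_one h0 h1 hχ0 x) (limitProb_nonneg h0 h1 hχ0 x) hM.le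
          exact zpow_le_zpow_right_of_le_one₀ h0 h1.le (by omega)
      _ = 1 / (t / (1 - t)) * (t / (1 - t) * t ^ M) := by
          rw [← mul_assoc, one_div_mul_cancel hc0.ne', one_mul, mul_one]
      _ ≤ _ := by
          refine mul_le_mul (le_add_of_nonneg_right hB) ?_ (by positivity) (by positivity)
          gcongr
  · calc t ^ (M - x) * limitProb t χ x
        ≤ t ^ (M - x) * (1 / qPochInf t t * (∑' m, |qCoef t m| * t⁻¹ ^ m) * (χ * t ^ x)) := by
          gcongr
          exact limitProb_le_mul_zpow h0 h1 hχ0 x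
      _ = 1 / qPochInf t t * (∑' m, |qCoef t m| * t⁻¹ ^ m) * (χ * t ^ M) := by
          rw [zpow_sub₀ h0.ne']
          have : t ^ x ≠ 0 := (zpow_pos h0 x).ne'
          field_simp
      _ ≤ _ := by
          gcongr
          exact le_add_of_nonneg_left (by positivity)

/-- A constant in the bound on the distance between the law of the shifted corank and the limit
law. -/
noncomputable def corankConst (t : ℝ) : ℝ :=
  1 / qPochInf t t * (∑' m, |qCoef t m|)
    + (1 / qPochInf t t * (1 / (1 - t)) + 1) *
      (1 / (t / (1 - t)) + 1 / qPochInf t t * ∑' m, |qCoef t m| * t⁻¹ ^ m)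

/-- The error term in the comparison of the law of the shifted corank with the limit law. -/
noncomputable def corankError (t : ℝ) (N s : ℕ) : ℝ :=
  survivalConst t / s + (Real.exp (s * (t / (1 - t)) * t ^ N) - 1) + s * (t / (1 - t)) * t ^ N

lemma limitProb_le_of_lt {χ : ℝ} (hχ : t / (1 - t) ≤ χ) {M x : ℤ} (hx : M ≤ x) :
    limitProb t χ x
      ≤ (1 / (t / (1 - t)) + 1 / qPochInf t t * ∑' m, |qCoef t m| * t⁻¹ ^ m) * (χ * t ^ M) := by
  have h2 : 0 < 1 - t := by linarith
  have hc0 : 0 < t / (1 - t) := by positivity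
  have hχ0 : 0 < χ := hc0.trans_le hχ
  refine le_trans ?_ (zpow_mul_limitProb_le h0 h1 hχ M x)
  exact le_mul_of_one_le_left (limitProb_nonneg h0 h1 hχ0 x)
    (one_le_zpow_of_nonpos₀ h0 h1.le (by omega))

lemma corankError_parts (N s : ℕ) :
    survivalConst t / s + (Real.exp (s * (t / (1 - t)) * t ^ N) - 1) ≤ corankError t N s ∧
      s * (t / (1 - t)) * t ^ N ≤ corankError t N s ∧
      survivalConst t / s ≤ corankError t N s ∧ 0 ≤ corankError t N s := by
  have h2 : 0 < 1 - t := by linarith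
  have h3 := survivalConst_nonneg h0 h1
  have h4 : 0 ≤ survivalConst t / s := by positivity
  have h5 : 0 ≤ s * (t / (1 - t)) * t ^ N := by positivity
  have h6 := Real.one_le_exp h5
  unfold corankError
  exact ⟨by linarith, by linarith, by linarith, by linarith⟩

section Compare

variable {χ : ℝ} {N s : ℕ} {L : ℤ} (hs : 1 ≤ s) (hχ : t / (1 - t) ≤ χ)
  (hL : χ = s * (t / (1 - t)) * t ^ L)
include hs hL

lemma limitProb_le_corankError_of_neg {x : ℤ} (hx : x + L < 0) :
    limitProb t χ x ≤ corankConst t * corankError t N s := by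
  have h2 : 0 < 1 - t := by linarith
  have hP := qPochInf_self_pos h0 h1
  obtain ⟨-, -, h3, h4⟩ := corankError_parts h0 h1 N s
  have h5 : ∀ m : ℕ, |Real.exp (-χ * t ^ (x - (m : ℤ)))| ≤ corankError t N s := fun m => by
    rw [abs_of_pos (Real.exp_pos _)]
    refine le_trans (le_of_eq ?_) ((exp_neg_zpow_le h0 h1 hs (k := x + L - m) (by omega)).trans h3)
    rw [hL, show x + L - (m : ℤ) = L + (x - m) by ring, zpow_add₀ h0.ne']
    congr 1
    ring
  rw [limitProb_eq]
  calc 1 / qPochInf t t * ∑' m : ℕ, qCoef t m * Real.exp (-χ * t ^ (x - (m : ℤ)))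
      ≤ 1 / qPochInf t t * ((∑' m, |qCoef t m|) * corankError t N s) := by
        gcongr
        exact (le_abs_self _).trans (abs_tsum_qCoef_mul_le h0 h1 h5)
    _ = (1 / qPochInf t t * ∑' m, |qCoef t m|) * corankError t N s := by ring
    _ ≤ _ := by
        refine mul_le_mul_of_nonneg_right ?_ h4
        unfold corankConst
        have : 0 ≤ ∑' m, |qCoef t m| * t⁻¹ ^ m := tsum_nonneg fun m => by positivity
        exact le_add_of_nonneg_right (by positivity)

include hχ

lemma limitProb_le_corankError_of_lt {x : ℤ} (hx : (N : ℤ) < x + L) :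
    limitProb t χ x ≤ corankConst t * corankError t N s := by
  have h2 : 0 < 1 - t := by linarith
  have hP := qPochInf_self_pos h0 h1
  obtain ⟨-, h3, -, h4⟩ := corankError_parts h0 h1 N s
  have h5 : 0 ≤ ∑' m, |qCoef t m| * t⁻¹ ^ m := tsum_nonneg fun m => by positivity
  have h6 : 0 ≤ ∑' m, |qCoef t m| := tsum_nonneg fun m => by positivity
  have h7 : χ * t ^ ((N : ℤ) - L) = s * (t / (1 - t)) * t ^ N := by
    rw [hL, zpow_sub₀ h0.ne', zpow_natCast]
    have : t ^ L ≠ 0 := (zpow_pos h0 L).ne'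
    field_simp
  refine (limitProb_le_of_lt h0 h1 hχ (M := (N : ℤ) - L) (by omega)).trans ?_
  rw [h7]
  refine mul_le_mul ?_ h3 (by positivity) ?_
  · unfold corankConst
    rw [add_mul _ (1 : ℝ), one_mul, ← add_assoc]
    exact le_add_of_nonneg_left (by positivity)
  · unfold corankConst
    positivity

lemma abs_sum_sub_limitProb_le {K : ℕ} (hK : K ≤ N) {x : ℤ} (hx : x + L = K) :
    |1 / qPoch t t (N - K) * ∑ m ∈ Finset.range (K + 1),
        qCoef t m * (qPoch t t N / qPoch t t (K - m)) ^ (s + 1) - limitProb t χ x|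
      ≤ corankConst t * corankError t N s := by
  have h2 : 0 < 1 - t := by linarith
  have hc0 : 0 < t / (1 - t) := by positivity
  have hχ0 : 0 < χ := hc0.trans_le hχ
  have hP := qPochInf_self_pos h0 h1
  have hPR := qPoch_self_pos h0 h1 (N - K)
  have hPle := qPochInf_self_le h0 h1 (N - K)
  have hPR1 : 1 / qPoch t t (N - K) ≤ 1 / qPochInf t t := one_div_le_one_div_of_le hP hPle
  obtain ⟨herr1, herr2, herr3, herr0⟩ := corankError_parts h0 h1 N s
  -- Extending the finite sum by 0 lets both series be compared termwise against the summable
  -- weights |`qCoef t m`|.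
  set F : ℕ → ℝ := fun m =>
    if m ∈ Finset.range (K + 1) then (qPoch t t N / qPoch t t (K - m)) ^ (s + 1) else 0 with hF
  set G : ℕ → ℝ := fun m => Real.exp (-χ * t ^ (x - (m : ℤ))) with hG
  have hGk : ∀ m, G m = Real.exp (-(s * (t / (1 - t)) * t ^ ((K : ℤ) - m))) := fun m => by
    rw [hG, ← hx, hL, show x + L - (m : ℤ) = L + (x - m) by ring, zpow_add₀ h0.ne']
    simp only
    congr 1
    ring
  have hFG : ∀ m, |F m - G m| ≤ corankError t N s := fun m => by
    by_cases hm : m ∈ Finset.range (K + 1)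
    · have hmK : m ≤ K := Nat.lt_succ_iff.1 (Finset.mem_range.1 hm)
      obtain ⟨j, rfl⟩ := Nat.exists_eq_add_of_le hmK
      obtain ⟨n, rfl⟩ := Nat.exists_eq_add_of_le hK
      refine le_trans ?_ herr1
      have h3 := abs_div_pow_sub_exp_le h0 h1 hs j (m + n)
      rw [hGk]
      simp only [hF, if_pos hm, Nat.add_sub_cancel_left]
      rw [show ((m + j : ℕ) : ℤ) - m = j by push_cast; ring, zpow_natCast,
        show m + j + n = j + (m + n) by ring]
      exact h3
    · have hmK : K < m := by simpa [Nat.lt_succ_iff] using hm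
      simp only [hF, if_neg hm, zero_sub, abs_neg]
      rw [abs_of_pos (Real.exp_pos _)]
      change G m ≤ _
      rw [hGk]
      exact (exp_neg_zpow_le h0 h1 hs (by omega)).trans herr3
  have hsum : ∑ m ∈ Finset.range (K + 1), qCoef t m * (qPoch t t N / qPoch t t (K - m)) ^ (s + 1)
      = ∑' m, qCoef t m * F m := by
    rw [tsum_eq_sum (s := Finset.range (K + 1)) fun m hm => by simp only [hF, if_neg hm, mul_zero]]
    exact Finset.sum_congr rfl fun m hm => by simp only [hF, if_pos hm]
  have hGs : Summable fun m => qCoef t m * G m :=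
    summable_qCoef_mul h0 h1 fun m => abs_exp_neg_mul_zpow_le_one h0 hχ0 _
  have hFs : Summable fun m => qCoef t m * F m :=
    summable_of_ne_finset_zero (s := Finset.range (K + 1)) fun m hm => by
      simp only [hF, if_neg hm, mul_zero]
  have hlp : ∑' m, qCoef t m * G m = qPochInf t t * limitProb t χ x := by
    rw [limitProb_eq, ← mul_assoc, mul_one_div_cancel hP.ne', one_mul]
  have hdiff := abs_tsum_qCoef_mul_le h0 h1 hFG
  simp only [mul_sub] at hdiff
  rw [hFs.tsum_sub hGs, hlp] at hdiff
  rw [hsum]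
  -- Two separate errors: replacing F by G, and replacing the prefactor 1/(t;t)_{N-K} by 1/(t;t)_∞.
  -- The latter costs about t^{N-K} times the limit probability.
  have hdecomp : 1 / qPoch t t (N - K) * ∑' m, qCoef t m * F m - limitProb t χ x
      = 1 / qPoch t t (N - K) * (∑' m, qCoef t m * F m - qPochInf t t * limitProb t χ x)
        - 1 / qPoch t t (N - K) * ((qPoch t t (N - K) - qPochInf t t) * limitProb t χ x) := by
    field_simp
    ring
  have hnn := limitProb_nonneg h0 h1 hχ0 x
  have hA : |1 / qPoch t t (N - K) * (∑' m, qCoef t m * F m - qPochInf t t * limitProb t χ x)|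
      ≤ 1 / qPochInf t t * (∑' m, |qCoef t m|) * corankError t N s := by
    rw [abs_mul, abs_of_pos (one_div_pos.2 hPR), mul_assoc]
    exact mul_le_mul hPR1 hdiff (abs_nonneg _) (one_div_pos.2 hP).le
  set B := 1 / (t / (1 - t)) + 1 / qPochInf t t * ∑' m, |qCoef t m| * t⁻¹ ^ m with hB
  have hB0 : 0 ≤ B := by
    have : 0 ≤ ∑' m, |qCoef t m| * t⁻¹ ^ m := tsum_nonneg fun m => by positivity
    positivity
  have hC : |1 / qPoch t t (N - K) * ((qPoch t t (N - K) - qPochInf t t) * limitProb t χ x)|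
      ≤ 1 / qPochInf t t * (1 / (1 - t)) * B * corankError t N s := by
    have h3 := qPoch_self_sub_qPochInf_le h0 h1 (N - K)
    have h4 : t ^ (N - K) * limitProb t χ x ≤ B * corankError t N s := by
      have h5 := zpow_mul_limitProb_le h0 h1 hχ ((N : ℤ) - L) x
      have h6 : ((N : ℤ) - L) - x = ((N - K : ℕ) : ℤ) := by push_cast [hK]; omega
      have h7 : χ * t ^ ((N : ℤ) - L) = s * (t / (1 - t)) * t ^ N := by
        rw [hL, zpow_sub₀ h0.ne', zpow_natCast]
        have : t ^ L ≠ 0 := (zpow_pos h0 L).ne'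
        field_simp
      rw [h6, h7, zpow_natCast] at h5
      exact h5.trans (mul_le_mul_of_nonneg_left herr2 hB0)
    rw [abs_of_nonneg (mul_nonneg (one_div_pos.2 hPR).le
      (mul_nonneg (sub_nonneg.2 hPle) hnn)), mul_assoc, mul_assoc]
    refine mul_le_mul hPR1 ?_ (mul_nonneg (sub_nonneg.2 hPle) hnn) (one_div_pos.2 hP).le
    calc (qPoch t t (N - K) - qPochInf t t) * limitProb t χ x
        ≤ t ^ (N - K) / (1 - t) * limitProb t χ x := by gcongr
      _ = 1 / (1 - t) * (t ^ (N - K) * limitProb t χ x) := by ring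
      _ ≤ 1 / (1 - t) * (B * corankError t N s) := by gcongr
  rw [hdecomp]
  refine (abs_sub _ _).trans ((add_le_add hA hC).trans ?_)
  have hfin : corankConst t * corankError t N s
      = 1 / qPochInf t t * (∑' m, |qCoef t m|) * corankError t N s
        + 1 / qPochInf t t * (1 / (1 - t)) * B * corankError t N s + B * corankError t N s := by
    rw [corankConst, ← hB]
    ring
  rw [hfin]
  exact le_add_of_nonneg_right (mul_nonneg hB0 herr0)

end Compare

end Asymptotics

/-! ### From the rank to the shifted corank, and the limit. -/

section Corank

variable {p : ℕ} [Fact p.Prime] {N : ℕ} {Ω : Type*} [MeasurableSpace Ω] {P : Measure Ω}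
  {A : ℕ → Ω → Matrix (Fin N) (Fin N) (ZMod p)}

lemma aemeasurable_shiftedCorank (hA : ∀ i, AEMeasurable (A i) P) (s : ℕ) :
    AEMeasurable (fun ω => shiftedCorank p s (fun i => A i ω)) P :=
  (Measurable.of_discrete (f := fun C : Matrix (Fin N) (Fin N) (ZMod p) =>
    corank C - ⌊Real.logb p s⌋)).comp_aemeasurable (aemeasurable_leftProd hA s)

variable [IsProbabilityMeasure P]

lemma measureReal_corank_leftProd_eq (hindep : iIndepFun A P)
    (hunif : ∀ i, HasLaw (A i) (uniformOn Set.univ) P) (s : ℕ) {K : ℕ} (hK : K ≤ N) :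
    P.real {ω | corank (leftProd (fun i => A i ω) s) = K}
      = 1 / qPoch (p : ℝ)⁻¹ (p : ℝ)⁻¹ (N - K) * ∑ m ∈ Finset.range (K + 1),
          qCoef (p : ℝ)⁻¹ m *
            (qPoch (p : ℝ)⁻¹ (p : ℝ)⁻¹ N / qPoch (p : ℝ)⁻¹ (p : ℝ)⁻¹ (K - m)) ^ (s + 1) := by
  have hset : {ω | corank (leftProd (fun i => A i ω) s) = K}
      = {ω | (leftProd (fun i => A i ω) s).rank = N - K} := by
    ext ω
    simp only [Set.mem_ofPred_eq, corank]
    have : (leftProd (fun i => A i ω) s).rank ≤ N := by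
      simpa using (leftProd (fun i => A i ω) s).rank_le_width
    omega
  rw [hset, measureReal_rank_leftProd_eq hindep hunif, Nat.sub_sub_self hK]
  congr 1
  refine Finset.sum_congr rfl fun m hm => ?_
  have hm' := Finset.mem_range.1 hm
  rw [injProb, if_pos (by omega), show N - (N - K + m) = K - m by omega]

lemma abs_measureReal_shiftedCorank_sub_le (hindep : iIndepFun A P)
    (hunif : ∀ i, HasLaw (A i) (uniformOn Set.univ) P) {s : ℕ} (hs : 1 ≤ s) (x : ℤ) :
    |(P.map fun ω => shiftedCorank p s (fun i => A i ω)).real {x}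
        - limitProb (p : ℝ)⁻¹ ((p : ℝ) ^ Int.fract (Real.logb p s) / ((p : ℝ) - 1)) x|
      ≤ corankConst (p : ℝ)⁻¹ * corankError (p : ℝ)⁻¹ N s := by
  have h0 := inv_prime_pos p
  have h1 := inv_prime_lt_one p
  have hp1 : (1 : ℝ) < p := by exact_mod_cast (Fact.out : p.Prime).one_lt
  have hp0 : (0 : ℝ) < p := by linarith
  have hp2 : (p : ℝ) - 1 ≠ 0 := by linarith
  have hp3 : (0 : ℝ) < p - 1 := by linarith
  set L := ⌊Real.logb p s⌋ with hLdef
  set χ := (p : ℝ) ^ Int.fract (Real.logb p s) / ((p : ℝ) - 1) with hχdef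
  have hc : (p : ℝ)⁻¹ / (1 - (p : ℝ)⁻¹) = 1 / ((p : ℝ) - 1) := by
    have : 1 - (p : ℝ)⁻¹ ≠ 0 := by linarith
    field_simp
  have hχ : (p : ℝ)⁻¹ / (1 - (p : ℝ)⁻¹) ≤ χ := by
    rw [hc, hχdef]
    gcongr
    exact Real.one_le_rpow hp1.le (Int.fract_nonneg _)
  -- The fractional part enters here: p^{fract(log_p s)} = s p^{-L}, so shifting the corank by L
  -- produces exactly this χ.
  have hL : χ = s * ((p : ℝ)⁻¹ / (1 - (p : ℝ)⁻¹)) * (p : ℝ)⁻¹ ^ L := by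
    have hs0 : (0 : ℝ) < s := by exact_mod_cast hs
    have h3 : (p : ℝ) ^ Int.fract (Real.logb p s) = s * (p : ℝ)⁻¹ ^ L := by
      rw [Int.fract, Real.rpow_sub hp0, Real.rpow_logb hp0 hp1.ne' hs0, ← hLdef,
        Real.rpow_intCast, inv_zpow, div_eq_mul_inv]
    rw [hχdef, hc, h3]
    ring
  have hχ0 : 0 < χ := by positivity
  have hA : ∀ i, AEMeasurable (A i) P := fun i => (hunif i).aemeasurable
  have hnn := limitProb_nonneg h0 h1 hχ0 x
  have hmap : (P.map fun ω => shiftedCorank p s (fun i => A i ω)).real {x}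
      = P.real {ω | corank (leftProd (fun i => A i ω) s) = x + L} := by
    rw [map_measureReal_apply_of_aemeasurable (aemeasurable_shiftedCorank hA s)
      (measurableSet_singleton x)]
    congr 1
    ext ω
    simp only [Set.mem_preimage, Set.mem_singleton_iff, Set.mem_ofPred_eq, shiftedCorank]
    exact sub_eq_iff_eq_add
  have hempty : x + L < 0 ∨ (N : ℤ) < x + L →
      P.real {ω | corank (leftProd (fun i => A i ω) s) = x + L} = 0 := fun h => by
    have : {ω | corank (leftProd (fun i => A i ω) s) = x + L} = ∅ := by
      refine Set.eq_empty_of_forall_notMem fun ω hω => ?_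
      have hω' : (N : ℤ) - ((leftProd (fun i => A i ω) s).rank : ℤ) = x + L := hω
      have : (leftProd (fun i => A i ω) s).rank ≤ N := by
        simpa using (leftProd (fun i => A i ω) s).rank_le_width
      omega
    rw [this, measureReal_empty]
  rw [hmap]
  -- Outside 0 ≤ x + L ≤ N the corank has no mass, so only the limit probability needs to be small
  -- there.
  rcases lt_or_ge (x + L) 0 with hneg | hnneg
  · rw [hempty (Or.inl hneg), zero_sub, abs_neg, abs_of_nonneg hnn]
    exact limitProb_le_corankError_of_neg h0 h1 hs hL hneg
  rcases lt_or_ge (N : ℤ) (x + L) with hbig | hle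
  · rw [hempty (Or.inr hbig), zero_sub, abs_neg, abs_of_nonneg hnn]
    exact limitProb_le_corankError_of_lt h0 h1 hs hχ hL hbig
  obtain ⟨K, hK⟩ := Int.eq_ofNat_of_zero_le hnneg
  have hKN : K ≤ N := by omega
  rw [hK, measureReal_corank_leftProd_eq hindep hunif s hKN]
  exact abs_sum_sub_limitProb_le h0 h1 hs hχ hL hKN hK

end Corank

lemma tendsto_corankError (p : ℕ) [Fact p.Prime] {s : ℕ → ℕ} (hs : Tendsto s atTop atTop)
    (hNs : Tendsto (fun N : ℕ => (N : ℝ) - Real.logb p (s N)) atTop atTop) :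
    Tendsto (fun N => corankError (p : ℝ)⁻¹ N (s N)) atTop (𝓝 0) := by
  have hp1 : (1 : ℝ) < p := by exact_mod_cast (Fact.out : p.Prime).one_lt
  have hp0 : (0 : ℝ) < p := by linarith
  -- Here s p^{-N} = p^{-(N - log_p s)}, which is where the growth of N - log_p s is used.
  have hA : Tendsto (fun N => (s N : ℝ) * (p : ℝ)⁻¹ ^ N) atTop (𝓝 0) := by
    have h2 : Tendsto (fun N : ℕ => Real.exp (-(((N : ℝ) - Real.logb p (s N)) * Real.log p)))
        atTop (𝓝 0) :=
      Real.tendsto_exp_neg_atTop_nhds_zero.comp (hNs.atTop_mul_const (Real.log_pos hp1))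
    refine h2.congr' ?_
    filter_upwards [hs.eventually_ge_atTop 1] with N hN
    have hs0 : (0 : ℝ) < s N := by exact_mod_cast hN
    rw [show -(((N : ℝ) - Real.logb p (s N)) * Real.log p)
      = Real.log p * (Real.logb p (s N) - N) by ring, ← Real.rpow_def_of_pos hp0,
      Real.rpow_sub hp0, Real.rpow_logb hp0 hp1.ne' hs0, Real.rpow_natCast, inv_pow,
      div_eq_mul_inv]
  have hB : Tendsto (fun N => s N * ((p : ℝ)⁻¹ / (1 - (p : ℝ)⁻¹)) * (p : ℝ)⁻¹ ^ N) atTop (𝓝 0) := by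
    have := hA.mul_const ((p : ℝ)⁻¹ / (1 - (p : ℝ)⁻¹))
    rw [zero_mul] at this
    exact this.congr fun N => by ring
  have hC : Tendsto (fun N => survivalConst (p : ℝ)⁻¹ / (s N : ℝ)) atTop (𝓝 0) :=
    tendsto_const_nhds.div_atTop (tendsto_natCast_atTop_atTop.comp hs)
  have hD := ((Real.continuous_exp.tendsto 0).comp hB).sub_const 1
  have := (hC.add hD).add hB
  simpa [corankError] using this

theorem mainTheorem6 (p : ℕ) [Fact p.Prime]
    {Ω : ℕ → Type*} [∀ N, MeasurableSpace (Ω N)]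
    (P : ∀ N, Measure (Ω N)) [∀ N, IsProbabilityMeasure (P N)]
    -- `A N i` is the `(i+1)`-st of the random `N × N` matrices
    (A : ∀ N : ℕ, ℕ → Ω N → Matrix (Fin N) (Fin N) (ZMod p))
    (hindep : ∀ N, 1 ≤ N → iIndepFun (A N) (P N))
    (hunif : ∀ N, 1 ≤ N → ∀ i, HasLaw (A N i) (uniformOn Set.univ) (P N))
    (s : ℕ → ℕ) (hs : Tendsto s atTop atTop)
    (hNs : Tendsto (fun N : ℕ => (N : ℝ) - Real.logb p (s N)) atTop atTop) :
    -- the explicit formula is a probability law on `ℤ`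
    (∀ t χ : ℝ, 0 < t → t < 1 → 0 < χ →
      IsProbabilityMeasure (limitLaw t χ) ∧
      ∀ x : ℤ, Summable (limitTerm t χ x) ∧ (limitLaw t χ).real {x} = limitProb t χ x) ∧
    -- the shifted corank is a random variable, and its law is asymptotically close to that law
    (∀ N, 1 ≤ N → AEMeasurable (fun ω => shiftedCorank p (s N) (fun i => A N i ω)) (P N)) ∧
    Tendsto (fun N : ℕ =>
      Dinf ((P N).map (fun ω => shiftedCorank p (s N) (fun i => A N i ω)))
        (limitLaw ((p : ℝ)⁻¹)
          ((p : ℝ) ^ Int.fract (Real.logb p (s N)) / ((p : ℝ) - 1))))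
      atTop (𝓝 0) := by
  refine ⟨fun t χ h0 h1 hχ => ⟨isProbabilityMeasure_limitLaw h0 h1 hχ, fun x =>
    ⟨summable_limitTerm h0 h1 hχ x, limitLaw_real_singleton h0 h1 hχ x⟩⟩,
    fun N hN => aemeasurable_shiftedCorank (fun i => (hunif N hN i).aemeasurable) _, ?_⟩
  have hp1 : (1 : ℝ) < p := by exact_mod_cast (Fact.out : p.Prime).one_lt
  have hlim := (tendsto_corankError p hs hNs).const_mul (corankConst (p : ℝ)⁻¹)
  rw [mul_zero] at hlim
  refine squeeze_zero' (Eventually.of_forall fun N => Real.iSup_nonneg fun x => abs_nonneg _) ?_ hlim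
  filter_upwards [eventually_ge_atTop 1, hs.eventually_ge_atTop 1] with N hN hsN
  refine ciSup_le fun x => ?_
  have hχ : 0 < (p : ℝ) ^ Int.fract (Real.logb p (s N)) / ((p : ℝ) - 1) :=
    div_pos (Real.rpow_pos_of_pos (by linarith) _) (by linarith)
  rw [limitLaw_real_singleton (inv_prime_pos p) (inv_prime_lt_one p) hχ]
  exact abs_measureReal_shiftedCorank_sub_le (hindep N hN) (hunif N hN) hsN x
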